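/- \textbf{Setting.} Let $X$ be a measurable space, $Y\subseteq\mathbb{R}$, and $\rho$ a probability measure on $X\times Y$. Let $V:\mathbb{R}\times\mathbb{R}\to[0,\infty)$ be a measurable loss, $\mathcal{F}$ a real separable Hilbert space and $\Phi:X\to\mathcal{F}$ a measurable feature map. For $w\in\mathcal{F}$ put $\mathcal{E}(w)=\int V(y,\langle w,\Phi(x)\rangle)\,d\rho(x,y)$, and for $\lambda\ge 0$ put $\mathcal{D}(\lambda)=\inf_{w\in\mathcal{F}}\{\mathcal{E}(w)+\frac{\lambda}{2}\|w\|^2\}-\inf_{w\in\mathcal{F}}\mathcal{E}(w)$. Assume: (1) $\kappa=\sup_{x\in X}\|\Phi(x)\|<\infty$; for every $y\in Y$ the function $V(y,\cdot)$ is convex; $\sup_{y\in Y}V(y,0)<\infty$; and the left-hand derivative $V'_-(y,\cdot)$ satisfies $|V'_-(y,a)|\le a_0$ for all $a\in\mathbb{R}$, $y\in Y$. (2) For some $\beta\in(0,1]$ and $c_\beta>0$, $\mathcal{D}(\lambda)\le c_\beta\lambda^\beta$ for all $\lambda>0$. (3) For every $y\in Y$, $V(y,\cdot)$ is differentiable and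 its derivative is Lipschitz continuous with constant $L>0$. Let $m\ge 1$, let $z=\{(x_i,y_i)\}_{i=1}^m$ be drawn i.i.d. from $\rho$, and let $j_1,j_2,\dots$ be i.i.d. uniform on $\{1,\dots,m\}$, independent of $z$. The stochastic gradient method with step-sizes $\eta_t=\eta_1t^{-\beta/(\beta+1)}$ $(t\ge 1)$, where $\eta_1>0$ is a constant with $\eta_1\kappa^2L\le 2$, is $$w_1=0,\qquad w_{t+1}=w_t-\eta_tV'_-(y_{j_t},\langle w_t,\Phi(x_{j_t})\rangle)\Phi(x_{j_t}),\quad t\ge 1,$$ with averaged iterates $\overline{w}_t=\sum_{k=1}^t\eta_kw_k\big/\sum_{k=1}^t\eta_k$. Let $\mathbb{E}$ denote the expectation over $z$ and $(j_t)_t$. \textbf{Corollary.} There is a constant $C>0$, depending only on $\beta,c_\beta,\kappa,a_0,\eta_1$, such that for all $m\ge 1$, all $t\ge 1$, and both choices $g_t=\overline{w}_t$ and $g_t=w_t$, the expected excess risk exists and $$\mathbb{E}\Big[\mathcal{E}(g_t)-\inf_{w\in\mathcal{F}}\mathcal{E}(w)\Big]\le C\Big(m^{-1}t^{\frac{1}{\beta+1}}\log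 t+t^{-\frac{\beta}{\beta+1}}\log t+t^{-\frac{\beta}{\beta+1}}\Big).$$ In particular, for $t^*=m$ (one pass) and all $m\ge 2$, $$\mathbb{E}\Big[\mathcal{E}(g_{t^*})-\inf_{w\in\mathcal{F}}\mathcal{E}(w)\Big]\le C\,m^{-\frac{\beta}{\beta+1}}\log m.$$ -/

import Mathlib

open MeasureTheory

noncomputable section

namespace SGM

variable {X F : Type*} [MeasurableSpace X] [NormedAddCommGroup F] [InnerProductSpace ℝ F]
  {Y : Set ℝ}

/-- The left-hand derivative `V'₋(y, a)` of the loss in its second entry. -/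
def lossLeftDeriv (V : ℝ → ℝ → ℝ) (y a : ℝ) : ℝ :=
  derivWithin (V y) (Set.Iio a) a

/-- The expected risk `𝓔(w) = ∫ V(y, ⟨w, Φ(x)⟩) dρ(x, y)`. -/
def risk (ρ : Measure (X × Y)) (V : ℝ → ℝ → ℝ) (Φ : X → F) (w : F) : ℝ :=
  ∫ p, V p.2 (inner ℝ w (Φ p.1)) ∂ρ

/-- The approximation error
`𝓓(lam) = inf_w {𝓔(w) + (lam / 2) ‖w‖²} - inf_w 𝓔(w)`. -/
def approxError (ρ : Measure (X × Y)) (V : ℝ → ℝ → ℝ) (Φ : X → F) (lam : ℝ) : ℝ :=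
  (⨅ w : F, (risk ρ V Φ w + lam / 2 * ‖w‖ ^ 2)) - ⨅ w : F, risk ρ V Φ w

/-- Boundedness assumption: `κ = sup_x ‖Φ(x)‖ < ∞`, the loss is convex in its second entry,
`sup_{y ∈ Y} V(y, 0) < ∞`, and the left-hand derivative is bounded by `a₀`. -/
structure BoundednessAssumption (Y : Set ℝ) (V : ℝ → ℝ → ℝ) (Φ : X → F) (κ a₀ : ℝ) : Prop where
  isLUB_feature : IsLUB (Set.range fun x => ‖Φ x‖) κ
  convex : ∀ y ∈ Y, ConvexOn ℝ Set.univ (V y)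
  bddAbove_zero : BddAbove ((fun y => V y 0) '' Y)
  abs_leftDeriv_le : ∀ y ∈ Y, ∀ a : ℝ, |lossLeftDeriv V y a| ≤ a₀

/-- Approximation error assumption: `𝓓(lam) ≤ cβ lam ^ β` for all `lam > 0`. -/
def ApproximationAssumption (ρ : Measure (X × Y)) (V : ℝ → ℝ → ℝ) (Φ : X → F)
    (β cβ : ℝ) : Prop :=
  ∀ lam : ℝ, 0 < lam → approxError ρ V Φ lam ≤ cβ * lam ^ β

/-- Smoothness assumption: for `y ∈ Y`, `V(y, ·)` is differentiable and its derivative is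
Lipschitz with constant `L > 0`. -/
structure SmoothnessAssumption (Y : Set ℝ) (V : ℝ → ℝ → ℝ) (L : ℝ) : Prop where
  pos : 0 < L
  differentiable : ∀ y ∈ Y, Differentiable ℝ (V y)
  lipschitz_deriv : ∀ y ∈ Y, ∀ a b : ℝ, |deriv (V y) b - deriv (V y) a| ≤ L * |b - a|

/-- The iterates of the stochastic gradient method with step-sizes `η`, run on the sample `z`
along the indices `j 1, j 2, …`:  `w₁ = 0` and
`w_{t+1} = w_t - η_t V'₋(y_{j_t}, ⟨w_t, Φ(x_{j_t})⟩) Φ(x_{j_t})` for `t ≥ 1`.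
(The value at time `0` and the index `j 0` are dummies.) -/
def iterate {m : ℕ} (V : ℝ → ℝ → ℝ) (Φ : X → F) (η : ℕ → ℝ)
    (z : Fin m → X × Y) (j : ℕ → Fin m) : ℕ → F
  | 0 => 0
  | 1 => 0
  | t + 2 =>
    iterate V Φ η z j (t + 1) -
      (η (t + 1) * lossLeftDeriv V (z (j (t + 1))).2
        (inner ℝ (iterate V Φ η z j (t + 1)) (Φ (z (j (t + 1))).1))) • Φ (z (j (t + 1))).1

/-- The weighted averages `(∑_{k=1}^t η_k w_k) / (∑_{k=1}^t η_k)`. -/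
def averagedIterate {m : ℕ} (V : ℝ → ℝ → ℝ) (Φ : X → F) (η : ℕ → ℝ)
    (z : Fin m → X × Y) (j : ℕ → Fin m) (t : ℕ) : F :=
  (∑ k ∈ Finset.Icc 1 t, η k)⁻¹ • ∑ k ∈ Finset.Icc 1 t, η k • iterate V Φ η z j k

/-- The law of an i.i.d. sample of size `m` from `ρ`. -/
def sampleLaw (ρ : Measure (X × Y)) (m : ℕ) : Measure (Fin m → X × Y) :=
  Measure.pi fun _ => ρ

/-- The law of an i.i.d. sequence of indices, uniform on the `m` sample points. -/
def indexLaw (m : ℕ) [NeZero m] : Measure (ℕ → Fin m) :=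
  Measure.infinitePi fun _ => (PMF.uniformOfFintype (Fin m)).toMeasure

/-- The excess risk `𝓔(w) - inf 𝓔`. -/
def excessRisk (ρ : Measure (X × Y)) (V : ℝ → ℝ → ℝ) (Φ : X → F) (w : F) : ℝ :=
  risk ρ V Φ w - ⨅ v : F, risk ρ V Φ v

/-- The expected excess risk `𝔼_{z,J}[𝓔(g) - inf 𝓔]` of an estimator `g` depending on the
sample and on the indices exists and is at most `B`. The expectation is taken
with respect to the indices first, then with respect to the sample. -/
def ExpectedExcessRiskLE (ρ : Measure (X × Y)) (V : ℝ → ℝ → ℝ) (Φ : X → F) (m : ℕ) [NeZero m]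
    (g : (Fin m → X × Y) → (ℕ → Fin m) → F) (B : ℝ) : Prop :=
  Integrable (fun q : (Fin m → X × Y) × (ℕ → Fin m) => excessRisk ρ V Φ (g q.1 q.2))
    ((sampleLaw ρ m).prod (indexLaw m)) ∧
  ∫ z, ∫ j, excessRisk ρ V Φ (g z j) ∂(indexLaw m) ∂(sampleLaw ρ m) ≤ B

/-- The decaying step-sizes `η_t = η₁ t ^ (-β / (β + 1))`. -/
def stepSize (η₁ β : ℝ) (t : ℕ) : ℝ :=
  η₁ * (t : ℝ) ^ (-(β / (β + 1)))

end SGM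

end

/-! Convexity, bounded slopes and smoothness make each step `w ↦ w - c ∇ℓ(w)` with `0 ≤ c ≤ η₁`
nonexpansive (`norm_sub_smul_le`); this is the only use of `η₁ κ² L ≤ 2`, so the constant does not
see `L`. Write `B = a₀ κ` for the gradient bound.

Generalization: replacing one sample point moves the iterate only at the times that draw it, by at
most `2 B η_k` each. A fresh point exchanged with a sample point then bounds expected risk minus
empirical risk by `(2 B² / m) ∑_{k<t} η_k` (`integral_risk_le_of_stable`).

Optimization: on a fixed sample, expanding `‖w_{k+1} - v‖²` and telescoping gives the usual regret
bound. With `v` fixed it controls the weighted average; with `v = w_s` for every `s` it passes from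
the average to the last iterate (`last_le_weighted_average`).

Approximation: the comparison with `w` costs `‖w‖² / (2 ∑ η_k)`, so the infimum over `w` produces
`𝓓(1 / ∑ η_k)`, to which the decay assumption applies. Elementary sums for `η_k = η₁ k ^ (-β / (β +
1))` finish the proof. -/

namespace SGM

/-! ### Step-size sums, and passing from the average to the last term. -/

theorem sum_inv_Ico_le_two_mul_log (t : ℕ) (ht : 1 ≤ t) :
    ∑ k ∈ Finset.Ico 1 t, (k : ℝ)⁻¹ ≤ 2 * Real.log t := by
  induction t, ht using Nat.le_induction with
  | base => simp
  | succ n hn ih =>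
    rw [Finset.sum_Ico_succ_top hn]
    have hn' : (1 : ℝ) ≤ n := by exact_mod_cast hn
    have h0 : (0 : ℝ) < n := by linarith
    have h := Real.one_sub_inv_le_log_of_pos (x := ((n : ℝ) + 1) / n) (by positivity)
    rw [Real.log_div (by positivity) (by positivity)] at h
    -- This says `1 / n ≤ 2 / (n + 1)`; the factor 2 spares an additive constant, so the bound
    -- vanishes at `t = 1`.
    have h2 : (n : ℝ)⁻¹ ≤ 2 * (1 - (((n : ℝ) + 1) / n)⁻¹) := by
      rw [inv_div, one_sub_div (by positivity), inv_eq_one_div, ← mul_div_assoc,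
        div_le_div_iff₀ (by positivity) (by positivity)]
      linarith
    push_cast
    linarith

/-- A comparison of the last term of a sequence with its weighted average, when the weighted
deviations of the tails of the sequence from their first terms are controlled. -/
theorem last_le_weighted_average {η e : ℕ → ℝ} {c : ℝ} {t s : ℕ} (hη : ∀ k, 1 ≤ k → 0 < η k)
    (hs : 1 ≤ s) (hst : s ≤ t)
    (h : ∀ s, 1 ≤ s → s ≤ t → ∑ k ∈ Finset.Ico s (t + 1), η k * (e k - e s) ≤
      c * ∑ k ∈ Finset.Ico s (t + 1), η k ^ 2) :
    e t ≤ (∑ k ∈ Finset.Ico s (t + 1), η k * e k - c * ∑ k ∈ Finset.Ico s (t + 1), η k ^ 2) /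
        ∑ k ∈ Finset.Ico s (t + 1), η k +
      c * (η t + ∑ k ∈ Finset.Ico s t, η k ^ 2 / ∑ i ∈ Finset.Ico (k + 1) (t + 1), η i) := by
  revert hs
  induction hst using Nat.decreasingInduction with
  | self =>
    intro hs
    have := hη t hs
    simp only [Finset.sum_Ico_succ_top le_rfl, Finset.Ico_self, Finset.sum_empty, zero_add,
      add_zero]
    rw [← sub_le_iff_le_add, le_div_iff₀ this]
    linarith
  | of_succ s hst ih =>
    intro hs
    refine (ih (by omega)).trans ?_
    have hs' := h s hs hst.le
    have hpos := hη s hs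
    simp only [mul_sub, Finset.sum_sub_distrib, ← Finset.sum_mul] at hs'
    rw [Finset.sum_eq_sum_Ico_succ_bot (by omega : s < t + 1) (fun k => η k * e k),
      Finset.sum_eq_sum_Ico_succ_bot (by omega : s < t + 1) η,
      Finset.sum_eq_sum_Ico_succ_bot (by omega : s < t + 1) (fun k => η k ^ 2)] at hs' ⊢
    rw [Finset.sum_eq_sum_Ico_succ_bot hst]
    have hA : 0 < ∑ k ∈ Finset.Ico (s + 1) (t + 1), η k :=
      Finset.sum_pos (fun k hk => hη k (by simp at hk; omega)) ⟨t, by simp; omega⟩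
    set A := ∑ k ∈ Finset.Ico (s + 1) (t + 1), η k
    set N := ∑ k ∈ Finset.Ico (s + 1) (t + 1), η k * e k
    set Q := ∑ k ∈ Finset.Ico (s + 1) (t + 1), η k ^ 2
    -- The hypothesis at `s` bounds the corrected tail average by `e s + c η_s² / A`, so adjoining
    -- the term `e s` to the average costs at most `c η_s² / A`.
    have key : (N - c * Q) / A ≤
        (η s * e s + N - c * (η s ^ 2 + Q)) / (η s + A) + c * (η s ^ 2 / A) := by
      rw [← mul_div_assoc, div_add_div _ _ (by positivity) (by positivity),
        div_le_div_iff₀ (by positivity) (by positivity)]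
      have : η s * (N - c * Q) ≤ η s * (A * e s + c * η s ^ 2) :=
        mul_le_mul_of_nonneg_left (by linarith) hpos.le
      nlinarith [mul_le_mul_of_nonneg_right this hA.le]
    linarith

theorem stepSize_pos {η₁ β : ℝ} (hη₁ : 0 < η₁) {k : ℕ} (hk : 1 ≤ k) : 0 < stepSize η₁ β k :=
  mul_pos hη₁ (Real.rpow_pos_of_pos (by exact_mod_cast hk) _)

theorem stepSize_nonneg {η₁ β : ℝ} (hη₁ : 0 < η₁) (k : ℕ) : 0 ≤ stepSize η₁ β k :=
  mul_nonneg hη₁.le (Real.rpow_nonneg (Nat.cast_nonneg k) _)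

theorem stepSize_anti {η₁ β : ℝ} (hη₁ : 0 < η₁) (hβ : 0 < β) {k l : ℕ} (hk : 1 ≤ k)
    (hkl : k ≤ l) : stepSize η₁ β l ≤ stepSize η₁ β k :=
  mul_le_mul_of_nonneg_left (Real.rpow_le_rpow_of_nonpos (by exact_mod_cast hk)
    (by exact_mod_cast hkl) (neg_nonpos.2 (by positivity))) hη₁.le

theorem stepSize_le {η₁ β : ℝ} (hη₁ : 0 < η₁) (hβ : 0 < β) {k : ℕ} (hk : 1 ≤ k) :
    stepSize η₁ β k ≤ η₁ := by
  simpa [stepSize] using stepSize_anti hη₁ hβ le_rfl hk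

theorem mul_stepSize_le_sum {η₁ β : ℝ} (hη₁ : 0 < η₁) (hβ : 0 < β) {s t : ℕ} (hs : 1 ≤ s) :
    ((t + 1 - s : ℕ) : ℝ) * stepSize η₁ β t ≤ ∑ k ∈ Finset.Ico s (t + 1), stepSize η₁ β k := by
  have := Finset.card_nsmul_le_sum (Finset.Ico s (t + 1)) (stepSize η₁ β) (stepSize η₁ β t)
    (fun k hk => stepSize_anti hη₁ hβ (by simp at hk; omega) (by simp at hk; omega))
  simpa using this

theorem one_sub_div_add_one {β : ℝ} (hβ : 0 < β) : 1 - β / (β + 1) = 1 / (β + 1) := by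
  field_simp
  ring

/-- Bounding `k ^ (1 / (β + 1)) / k` by `t ^ (1 / (β + 1)) / k` leaves a harmonic sum; the logarithm
lost here is allowed in the final rate. -/
theorem sum_stepSize_le {η₁ β : ℝ} (hη₁ : 0 < η₁) (hβ : 0 < β) {t : ℕ} (ht : 1 ≤ t) :
    ∑ k ∈ Finset.Ico 1 t, stepSize η₁ β k ≤
      η₁ * (t : ℝ) ^ (1 / (β + 1)) * (2 * Real.log t) := by
  refine le_trans ?_ (mul_le_mul_of_nonneg_left (sum_inv_Ico_le_two_mul_log t ht) (by positivity))
  rw [Finset.mul_sum]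
  refine Finset.sum_le_sum fun k hk => ?_
  simp only [Finset.mem_Ico] at hk
  have hk0 : (0 : ℝ) < k := by exact_mod_cast hk.1
  have : (k : ℝ) ^ (-(β / (β + 1))) = (k : ℝ) ^ (1 / (β + 1)) * (k : ℝ)⁻¹ := by
    rw [← Real.rpow_neg_one, ← Real.rpow_add hk0, ← one_sub_div_add_one hβ]
    congr 1
    ring
  rw [stepSize, this, mul_assoc]
  gcongr
  exact hk.2.le

/-- The inner sum is at least `(t - k) η_t`. With `θ = β / (β + 1)`, `β ≤ 1` means `θ ≤ 1 / 2`, so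
`k ^ (-2θ) ≤ t ^ (1 - 2θ) / k`. Then `t / (k (t - k)) = 1 / k + 1 / (t - k)` leaves two harmonic
sums, equal by reflection. -/
theorem sum_sq_stepSize_div_le {η₁ β : ℝ} (hη₁ : 0 < η₁) (hβ : 0 < β) (hβ₁ : β ≤ 1) {t : ℕ}
    (ht : 1 ≤ t) :
    ∑ k ∈ Finset.Ico 1 t, stepSize η₁ β k ^ 2 /
        ∑ i ∈ Finset.Ico (k + 1) (t + 1), stepSize η₁ β i ≤
      η₁ * (t : ℝ) ^ (-(β / (β + 1))) * (4 * Real.log t) := by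
  have ht0 : (0 : ℝ) < t := by exact_mod_cast ht
  have hrefl : ∑ k ∈ Finset.Ico 1 t, ((t : ℝ) - k)⁻¹ = ∑ k ∈ Finset.Ico 1 t, (k : ℝ)⁻¹ := by
    refine Finset.sum_nbij' (fun k => t - k) (fun k => t - k) ?_ ?_ ?_ ?_ ?_ <;>
      simp only [Finset.mem_Ico] <;> intro k hk
    · omega
    · omega
    · omega
    · omega
    · rw [Nat.cast_sub hk.2.le]
  have hlog := sum_inv_Ico_le_two_mul_log t ht
  have hsum : ∑ k ∈ Finset.Ico 1 t, ((k : ℝ)⁻¹ + ((t : ℝ) - k)⁻¹) ≤ 4 * Real.log t := by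
    rw [Finset.sum_add_distrib, hrefl]
    linarith
  refine le_trans ?_ (mul_le_mul_of_nonneg_left hsum (by positivity))
  rw [Finset.mul_sum]
  refine Finset.sum_le_sum fun k hk => ?_
  simp only [Finset.mem_Ico] at hk
  have hk0 : (0 : ℝ) < k := by exact_mod_cast hk.1
  have htk : (0 : ℝ) < t - k := sub_pos.2 (by exact_mod_cast hk.2)
  have hA := mul_stepSize_le_sum hη₁ hβ (s := k + 1) (t := t) (by omega)
  rw [Nat.add_sub_add_right, Nat.cast_sub hk.2.le] at hA
  have hθ : β / (β + 1) ≤ 1 / 2 := by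
    rw [div_le_div_iff₀ (by positivity) (by positivity)]
    linarith
  set θ := β / (β + 1)
  have hsq : ((k : ℝ) ^ (-θ)) ^ 2 = (k : ℝ) ^ (1 - 2 * θ) * (k : ℝ)⁻¹ := by
    rw [← Real.rpow_neg_one, ← Real.rpow_add hk0, ← Real.rpow_natCast, ← Real.rpow_mul hk0.le]
    congr 1
    push_cast
    ring
  have hsq' : ((t : ℝ) ^ (-θ)) ^ 2 = (t : ℝ) ^ (1 - 2 * θ) * (t : ℝ)⁻¹ := by
    rw [← Real.rpow_neg_one, ← Real.rpow_add ht0, ← Real.rpow_natCast, ← Real.rpow_mul ht0.le]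
    congr 1
    push_cast
    ring
  have hmono : (k : ℝ) ^ (1 - 2 * θ) ≤ (t : ℝ) ^ (1 - 2 * θ) :=
    Real.rpow_le_rpow hk0.le (by exact_mod_cast hk.2.le) (by linarith)
  have hη : 0 < stepSize η₁ β t := stepSize_pos hη₁ ht
  calc stepSize η₁ β k ^ 2 / ∑ i ∈ Finset.Ico (k + 1) (t + 1), stepSize η₁ β i
      ≤ stepSize η₁ β k ^ 2 / (((t : ℝ) - k) * stepSize η₁ β t) := by gcongr
    _ ≤ η₁ ^ 2 * ((t : ℝ) ^ (1 - 2 * θ) * (k : ℝ)⁻¹) / (((t : ℝ) - k) * stepSize η₁ β t) := by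
        rw [stepSize, mul_pow, hsq]
        gcongr
    _ = η₁ * (t : ℝ) ^ (-θ) * ((k : ℝ)⁻¹ + ((t : ℝ) - k)⁻¹) := by
        have : (t : ℝ) ^ (1 - 2 * θ) = ((t : ℝ) ^ (-θ)) ^ 2 * t := by
          rw [hsq']
          field_simp
        rw [this, stepSize]
        have hne : (t : ℝ) ^ (-θ) ≠ 0 := (Real.rpow_pos_of_pos ht0 _).ne'
        change η₁ ^ 2 * (((t : ℝ) ^ (-θ)) ^ 2 * t * (k : ℝ)⁻¹) / (((t : ℝ) - k) *
          (η₁ * (t : ℝ) ^ (-θ))) = _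
        field_simp
        ring

theorem inv_sum_stepSize_rpow_le {η₁ β : ℝ} (hη₁ : 0 < η₁) (hβ : 0 < β) {t : ℕ} (ht : 1 ≤ t) :
    ((∑ k ∈ Finset.Ico 1 (t + 1), stepSize η₁ β k)⁻¹) ^ β ≤
      η₁ ^ (-β) * (t : ℝ) ^ (-(β / (β + 1))) := by
  have ht0 : (0 : ℝ) < t := by exact_mod_cast ht
  have hA := mul_stepSize_le_sum hη₁ hβ (s := 1) (t := t) le_rfl
  rw [Nat.add_sub_cancel] at hA
  have heq : (t : ℝ) * stepSize η₁ β t = η₁ * (t : ℝ) ^ (1 / (β + 1)) := by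
    rw [stepSize, ← one_sub_div_add_one hβ, sub_eq_add_neg, Real.rpow_add ht0, Real.rpow_one]
    ring
  rw [heq] at hA
  have hpos : 0 < η₁ * (t : ℝ) ^ (1 / (β + 1)) := by positivity
  refine (Real.rpow_le_rpow (inv_nonneg.2 (hpos.le.trans hA)) (inv_anti₀ hpos hA) hβ.le).trans_eq ?_
  rw [Real.inv_rpow hpos.le, ← Real.rpow_neg hpos.le, Real.mul_rpow hη₁.le (by positivity),
    ← Real.rpow_mul ht0.le]
  congr 2
  ring

/-! ### Gradient steps along a deterministic stream of data. -/

section Descent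

variable {Z F : Type*} [NormedAddCommGroup F] [InnerProductSpace ℝ F]

/-- A convex loss `ℓ` with a measurable subgradient `G`, bounded by `B`, whose gradient steps of
size at most `η₁` are nonexpansive. -/
structure IsNonexpansiveLoss [MeasurableSpace Z] [MeasurableSpace F]
    (ℓ : Z → F → ℝ) (G : Z → F → F) (M B η₁ : ℝ) : Prop where
  measurable_loss : Measurable (Function.uncurry ℓ)
  measurable_grad : Measurable (Function.uncurry G)
  nonneg : ∀ p w, 0 ≤ ℓ p w
  zero_le : ∀ p, ℓ p 0 ≤ M
  norm_grad_le : ∀ p w, ‖G p w‖ ≤ B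
  sub_le_inner : ∀ p w v, ℓ p w - ℓ p v ≤ inner ℝ (G p w) (w - v)
  nonexpansive : ∀ p w v c, 0 ≤ c → c ≤ η₁ →
    ‖(w - c • G p w) - (v - c • G p v)‖ ≤ ‖w - v‖

/-- Gradient descent along a stream of data `p 1, p 2, …`, started from `0` at time `1`. -/
noncomputable def descent (G : Z → F → F) (η : ℕ → ℝ) (p : ℕ → Z) : ℕ → F
  | 0 => 0
  | 1 => 0
  | t + 2 => descent G η p (t + 1) - η (t + 1) • G (p (t + 1)) (descent G η p (t + 1))

theorem descent_one (G : Z → F → F) (η : ℕ → ℝ) (p : ℕ → Z) : descent G η p 1 = 0 := rfl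

theorem descent_succ (G : Z → F → F) (η : ℕ → ℝ) (p : ℕ → Z) {t : ℕ} (ht : 1 ≤ t) :
    descent G η p (t + 1) = descent G η p t - η t • G (p t) (descent G η p t) := by
  obtain ⟨t, rfl⟩ := Nat.exists_eq_add_of_le' ht
  rfl

theorem descent_congr (G : Z → F → F) (η : ℕ → ℝ) {p q : ℕ → Z} {t : ℕ} (ht : 1 ≤ t)
    (h : ∀ k < t, p k = q k) : descent G η p t = descent G η q t := by
  induction t, ht using Nat.le_induction with
  | base => rfl
  | succ n hn ih =>
    rw [descent_succ G η p hn, descent_succ G η q hn, ih fun k hk => h k (by omega),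
      h n (by omega)]

variable [MeasurableSpace Z] [MeasurableSpace F] {ℓ : Z → F → ℝ} {G : Z → F → F} {M B η₁ : ℝ}
  {η : ℕ → ℝ}

theorem measurable_descent [BorelSpace F] [SecondCountableTopology F] {Ω : Type*}
    [MeasurableSpace Ω] (O : IsNonexpansiveLoss ℓ G M B η₁) {p : Ω → ℕ → Z}
    (hp : ∀ k, Measurable fun ω => p ω k) {t : ℕ} (ht : 1 ≤ t) :
    Measurable fun ω => descent G η (p ω) t := by
  induction t, ht using Nat.le_induction with
  | base => exact measurable_const
  | succ n hn ih =>
    simp only [descent_succ G η _ hn]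
    exact ih.sub ((O.measurable_grad.comp ((hp n).prodMk ih)).const_smul (η n))

theorem norm_descent_le (O : IsNonexpansiveLoss ℓ G M B η₁) (hη : ∀ k, 0 ≤ η k) (p : ℕ → Z)
    {t : ℕ} (ht : 1 ≤ t) : ‖descent G η p t‖ ≤ ∑ k ∈ Finset.Ico 1 t, η k * B := by
  induction t, ht using Nat.le_induction with
  | base => simp [descent_one]
  | succ n hn ih =>
    rw [descent_succ G η p hn, Finset.sum_Ico_succ_top hn]
    refine (norm_sub_le _ _).trans (add_le_add ih ?_)
    rw [norm_smul, Real.norm_of_nonneg (hη n)]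
    exact mul_le_mul_of_nonneg_left (O.norm_grad_le _ _) (hη n)

/-- Stability of gradient descent: streams of data which differ at the times in `S` only. -/
theorem norm_descent_sub_descent_le (O : IsNonexpansiveLoss ℓ G M B η₁) (hη : ∀ k, 0 ≤ η k)
    (hη' : ∀ k, 1 ≤ k → η k ≤ η₁) {p q : ℕ → Z} (S : ℕ → Prop) [DecidablePred S]
    (hS : ∀ k, ¬ S k → p k = q k) {t : ℕ} (ht : 1 ≤ t) :
    ‖descent G η p t - descent G η q t‖ ≤
      ∑ k ∈ Finset.Ico 1 t, if S k then 2 * B * η k else 0 := by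
  induction t, ht using Nat.le_induction with
  | base => simp [descent_one]
  | succ n hn ih =>
    rw [descent_succ G η p hn, descent_succ G η q hn, Finset.sum_Ico_succ_top hn]
    split_ifs with hs
    -- At a time in `S` the two gradients are unrelated, so each contributes its norm bound `B`.
    · rw [sub_sub_sub_comm]
      refine (norm_sub_le _ _).trans (add_le_add ih ?_)
      rw [← smul_sub, norm_smul, Real.norm_of_nonneg (hη n)]
      have := (norm_sub_le (G (p n) (descent G η p n)) (G (q n) (descent G η q n))).trans
        (add_le_add (O.norm_grad_le _ _) (O.norm_grad_le _ _))
      nlinarith [hη n]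
    -- Off `S` both streams apply the same nonexpansive map.
    · rw [hS n hs, add_zero]
      exact (O.nonexpansive _ _ _ _ (hη n) (hη' n hn)).trans ih

/-- Expand the square: the cross term is controlled by the subgradient inequality, the last term by
the gradient bound. -/
theorem norm_sq_descent_succ_sub_le (O : IsNonexpansiveLoss ℓ G M B η₁) (hη : ∀ k, 0 ≤ η k)
    (p : ℕ → Z) {t : ℕ} (ht : 1 ≤ t) (v : F) :
    ‖descent G η p (t + 1) - v‖ ^ 2 ≤ ‖descent G η p t - v‖ ^ 2 -
      2 * η t * (ℓ (p t) (descent G η p t) - ℓ (p t) v) + η t ^ 2 * B ^ 2 := by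
  rw [descent_succ G η p ht, sub_right_comm, norm_sub_sq_real, inner_smul_right, norm_smul,
    mul_pow, Real.norm_of_nonneg (hη t), real_inner_comm]
  have h1 := mul_le_mul_of_nonneg_left (O.sub_le_inner (p t) (descent G η p t) v) (hη t)
  have h2 := mul_le_mul_of_nonneg_left (pow_le_pow_left₀ (norm_nonneg _)
    (O.norm_grad_le (p t) (descent G η p t)) 2) (sq_nonneg (η t))
  linarith

theorem IsNonexpansiveLoss.abs_sub_le (O : IsNonexpansiveLoss ℓ G M B η₁) (p : Z) (w v : F) :
    |ℓ p w - ℓ p v| ≤ B * ‖w - v‖ := by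
  have h : ∀ w v, ℓ p w - ℓ p v ≤ B * ‖w - v‖ := fun w v =>
    (O.sub_le_inner p w v).trans ((real_inner_le_norm _ _).trans
      (mul_le_mul_of_nonneg_right (O.norm_grad_le p w) (norm_nonneg _)))
  rw [abs_sub_le_iff]
  exact ⟨h w v, norm_sub_rev w v ▸ h v w⟩

theorem IsNonexpansiveLoss.abs_le (O : IsNonexpansiveLoss ℓ G M B η₁) (p : Z) {w : F} {W : ℝ}
    (hw : ‖w‖ ≤ W) : |ℓ p w| ≤ M + B * W := by
  have h := (abs_sub_le_iff.1 (O.abs_sub_le p w 0)).1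
  rw [sub_zero] at h
  have hB : 0 ≤ B := (norm_nonneg _).trans (O.norm_grad_le p w)
  rw [abs_of_nonneg (O.nonneg p w)]
  linarith [O.zero_le p, mul_le_mul_of_nonneg_left hw hB]

/-- Jensen's inequality for a loss with subgradients. -/
theorem IsNonexpansiveLoss.loss_sum_le (O : IsNonexpansiveLoss ℓ G M B η₁) (p : Z)
    {ι : Type*} (s : Finset ι) {a : ι → ℝ} (ha : ∀ i ∈ s, 0 ≤ a i) (ha1 : ∑ i ∈ s, a i = 1)
    (w : ι → F) : ℓ p (∑ i ∈ s, a i • w i) ≤ ∑ i ∈ s, a i * ℓ p (w i) := by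
  set v := ∑ i ∈ s, a i • w i with hv
  -- The subgradient inequalities at the barycentre `v` have linear parts that cancel on average.
  have h0 : ∑ i ∈ s, a i * inner ℝ (G p v) (v - w i) = 0 := by
    simp_rw [← inner_smul_right, ← inner_sum, smul_sub, Finset.sum_sub_distrib, ← Finset.sum_smul,
      ha1, one_smul, ← hv, sub_self, inner_zero_right]
  have h1 : ∑ i ∈ s, a i * (ℓ p v - ℓ p (w i)) ≤ 0 :=
    h0 ▸ Finset.sum_le_sum fun i hi => mul_le_mul_of_nonneg_left (O.sub_le_inner p v (w i)) (ha i hi)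
  simp only [mul_sub, Finset.sum_sub_distrib, ← Finset.sum_mul, ha1, one_mul] at h1
  linarith

end Descent

/-! ### Resampling one coordinate of an i.i.d. family. -/

section Resampling

variable {ι α : Type*} [DecidableEq ι] [MeasurableSpace α]

theorem measurable_update_prod (k : ι) :
    Measurable fun q : (ι → α) × α => Function.update q.1 k q.2 := by
  refine measurable_pi_iff.2 fun i => ?_
  by_cases h : i = k
  · subst h
    simpa using measurable_snd
  · simp only [Function.update_of_ne h]
    exact (measurable_pi_apply i).comp measurable_fst

/-- Resampling one coordinate does not change the law of an i.i.d. family. -/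
theorem measurePreserving_update_infinitePi (μ : Measure α) [IsProbabilityMeasure μ] (k : ι) :
    MeasurePreserving (fun q : (ι → α) × α => Function.update q.1 k q.2)
      ((Measure.infinitePi fun _ => μ).prod μ) (Measure.infinitePi fun _ => μ) := by
  refine ⟨measurable_update_prod k, Measure.eq_infinitePi _ fun s t ht => ?_⟩
  have hpre : (fun q : (ι → α) × α => Function.update q.1 k q.2) ⁻¹' Set.pi s t =
      Set.pi (s.erase k) t ×ˢ (if k ∈ s then t k else Set.univ) := by
    ext ⟨x, y⟩
    simp only [Set.mem_preimage, Set.mem_pi, Set.mem_prod, Finset.coe_erase, Set.mem_sdiff,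
      Finset.mem_coe, Set.mem_singleton_iff]
    constructor
    · intro h
      refine ⟨fun i hi => by simpa [hi.2] using h i hi.1, ?_⟩
      split_ifs with hk
      · simpa using h k hk
      · trivial
    · rintro ⟨h1, h2⟩ i hi
      by_cases hik : i = k
      · subst hik
        simpa [hi] using h2
      · simpa [hik] using h1 i ⟨hi, hik⟩
  rw [Measure.map_apply (measurable_update_prod k)
    (MeasurableSet.pi s.countable_toSet fun i _ => ht i), hpre, Measure.prod_prod,
    Measure.infinitePi_pi _ fun i _ => ht i]
  split_ifs with hk
  · rw [mul_comm, Finset.mul_prod_erase s (fun i => μ (t i)) hk]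
  · rw [measure_univ, mul_one, Finset.erase_eq_of_notMem hk]

/-- Used twice: for the index sequence, where it makes the stochastic gradient unbiased, and for the
sample, where it exchanges a data point with a fresh one. -/
theorem integral_infinitePi_update (μ : Measure α) [IsProbabilityMeasure μ] (k : ι)
    {h : (ι → α) → ℝ} (hm : Measurable h) {K : ℝ} (hK : ∀ x, |h x| ≤ K) :
    ∫ x, h x ∂(Measure.infinitePi fun _ => μ) =
      ∫ x, ∫ y, h (Function.update x k y) ∂μ ∂(Measure.infinitePi fun _ => μ) := by
  have hp := measurePreserving_update_infinitePi (ι := ι) μ k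
  rw [← integral_prod (fun q : (ι → α) × α => h (Function.update q.1 k q.2))
    (Integrable.of_bound (hm.comp hp.measurable).aestronglyMeasurable K (.of_forall fun q => hK _))]
  conv_lhs => rw [← hp.map_eq]
  exact integral_map hp.measurable.aemeasurable hm.aestronglyMeasurable

end Resampling

instance (m : ℕ) [NeZero m] : IsProbabilityMeasure (indexLaw m) := by
  unfold indexLaw
  infer_instance

/-- Independence of `j k` from the rest is expressed by `hinv`; averaging over the uniform `j k`
alone then turns a drawn loss into an empirical mean. -/
theorem integral_indexLaw_resample {m : ℕ} [NeZero m] (k : ℕ) {h : Fin m → (ℕ → Fin m) → ℝ}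
    (hm : ∀ i, Measurable (h i)) {K : ℝ} (hK : ∀ i j, |h i j| ≤ K)
    (hinv : ∀ i j x, h i (Function.update j k x) = h i j) :
    ∫ j, h (j k) j ∂(indexLaw m) = ∫ j, (m : ℝ)⁻¹ * ∑ i, h i j ∂(indexLaw m) := by
  have hm' : Measurable fun j : ℕ → Fin m => h (j k) j := by
    have : Measurable fun q : (ℕ → Fin m) × Fin m => h q.2 q.1 :=
      measurable_from_prod_countable_left hm
    exact this.comp (measurable_id.prodMk (measurable_pi_apply k))
  rw [indexLaw, integral_infinitePi_update _ k hm' fun j => hK _ _]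
  refine integral_congr_ae (.of_forall fun j => ?_)
  simp only [Function.update_self, hinv]
  rw [PMF.integral_eq_sum, Finset.mul_sum]
  simp

/-! ### Optimization error on a fixed sample, and generalization by stability. -/

section Risk

variable {Z F : Type*} [MeasurableSpace Z] [NormedAddCommGroup F] [InnerProductSpace ℝ F]
  [MeasurableSpace F] {ℓ : Z → F → ℝ} {G : Z → F → F} {M B η₁ : ℝ} {η : ℕ → ℝ} {m : ℕ}

/-- The average loss on a sample. -/
noncomputable def empiricalRisk (ℓ : Z → F → ℝ) (z : Fin m → Z) (w : F) : ℝ :=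
  (m : ℝ)⁻¹ * ∑ i, ℓ (z i) w

theorem IsNonexpansiveLoss.measurable_comp {Ω : Type*} [MeasurableSpace Ω]
    (O : IsNonexpansiveLoss ℓ G M B η₁) {p : Ω → Z} {g : Ω → F} (hp : Measurable p)
    (hg : Measurable g) : Measurable fun ω => ℓ (p ω) (g ω) :=
  O.measurable_loss.comp (hp.prodMk hg)

theorem IsNonexpansiveLoss.integrable_comp {Ω : Type*} [MeasurableSpace Ω] {μ : Measure Ω}
    [IsFiniteMeasure μ] (O : IsNonexpansiveLoss ℓ G M B η₁) {p : Ω → Z} {g : Ω → F}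
    (hp : Measurable p) (hg : Measurable g) {W : ℝ} (hW : ∀ ω, ‖g ω‖ ≤ W) :
    Integrable (fun ω => ℓ (p ω) (g ω)) μ :=
  Integrable.of_bound (O.measurable_comp hp hg).aestronglyMeasurable (M + B * W)
    (.of_forall fun ω => O.abs_le _ (hW ω))

theorem IsNonexpansiveLoss.integrable_empiricalRisk {Ω : Type*} [MeasurableSpace Ω]
    {μ : Measure Ω} [IsFiniteMeasure μ] (O : IsNonexpansiveLoss ℓ G M B η₁) {z : Ω → Fin m → Z}
    {g : Ω → F} (hz : ∀ i, Measurable fun ω => z ω i) (hg : Measurable g) {W : ℝ}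
    (hW : ∀ ω, ‖g ω‖ ≤ W) : Integrable (fun ω => empiricalRisk ℓ (z ω) (g ω)) μ :=
  (integrable_finsetSum _ fun i _ => O.integrable_comp (hz i) hg hW).const_mul _

/-- One step of the stochastic gradient method, on average. -/
theorem integral_norm_sq_descent_succ_le [NeZero m] [BorelSpace F] [SecondCountableTopology F]
    (O : IsNonexpansiveLoss ℓ G M B η₁) (hη : ∀ k, 0 ≤ η k) (z : Fin m → Z) {t : ℕ} (ht : 1 ≤ t)
    {v : (ℕ → Fin m) → F} (hv : Measurable v) {W : ℝ} (hW : ∀ j, ‖v j‖ ≤ W)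
    (hinv : ∀ j x, v (Function.update j t x) = v j) :
    ∫ j, ‖descent G η (fun k => z (j k)) (t + 1) - v j‖ ^ 2 ∂(indexLaw m) ≤
      ∫ j, ‖descent G η (fun k => z (j k)) t - v j‖ ^ 2 ∂(indexLaw m) -
        2 * η t * (∫ j, empiricalRisk ℓ z (descent G η (fun k => z (j k)) t) ∂(indexLaw m) -
          ∫ j, empiricalRisk ℓ z (v j) ∂(indexLaw m)) + η t ^ 2 * B ^ 2 := by
  have hz : ∀ k, Measurable fun j : ℕ → Fin m => z (j k) := fun k =>
    (measurable_of_finite z).comp (measurable_pi_apply k)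
  have hw : ∀ {t}, 1 ≤ t → Measurable fun j : ℕ → Fin m => descent G η (fun k => z (j k)) t :=
    fun ht => measurable_descent O hz ht
  have hwb : ∀ {t}, 1 ≤ t → ∀ j : ℕ → Fin m, ‖descent G η (fun k => z (j k)) t‖ ≤ _ :=
    fun ht j => norm_descent_le O hη _ ht
  have hsq : ∀ {t}, 1 ≤ t → Integrable (fun j : ℕ → Fin m =>
      ‖descent G η (fun k => z (j k)) t - v j‖ ^ 2) (indexLaw m) := fun {t} ht =>
    Integrable.of_bound ((((hw ht).sub hv).norm.pow_const 2).aestronglyMeasurable)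
      ((∑ k ∈ Finset.Ico 1 t, η k * B + W) ^ 2) (.of_forall fun j => by
        rw [Real.norm_of_nonneg (by positivity)]
        exact pow_le_pow_left₀ (norm_nonneg _)
          ((norm_sub_le _ _).trans (add_le_add (hwb ht j) (hW j))) 2)
  set w : (ℕ → Fin m) → F := fun j => descent G η (fun k => z (j k)) t with hwdef
  have hwt : Measurable w := hw ht
  -- The iterate at time `t` has only used the indices before `t`.
  have hwinv : ∀ j x, w (Function.update j t x) = w j := fun j x =>
    descent_congr G η ht fun k hk => by rw [Function.update_of_ne hk.ne]
  have hlin : ∫ j, (ℓ (z (j t)) (w j) - ℓ (z (j t)) (v j)) ∂(indexLaw m) =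
      ∫ j, empiricalRisk ℓ z (w j) ∂(indexLaw m) - ∫ j, empiricalRisk ℓ z (v j) ∂(indexLaw m) := by
    rw [integral_indexLaw_resample t (h := fun i j => ℓ (z i) (w j) - ℓ (z i) (v j))
      (fun i => (O.measurable_comp measurable_const hwt).sub (O.measurable_comp measurable_const hv))
      (fun i j => (abs_sub _ _).trans (add_le_add (O.abs_le _ (hwb ht j)) (O.abs_le _ (hW j))))
      (fun i j x => by simp only [hwinv, hinv]),
      ← integral_sub (O.integrable_empiricalRisk (z := fun _ => z) (fun _ => measurable_const) hwt
        (hwb ht)) (O.integrable_empiricalRisk (z := fun _ => z) (fun _ => measurable_const) hv hW)]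
    simp only [empiricalRisk, Finset.sum_sub_distrib, mul_sub]
  have hsqt : Integrable (fun j => ‖w j - v j‖ ^ 2) (indexLaw m) := hsq ht
  have hint : Integrable (fun j => ℓ (z (j t)) (w j) - ℓ (z (j t)) (v j)) (indexLaw m) :=
    (O.integrable_comp (hz t) hwt (hwb ht)).sub (O.integrable_comp (hz t) hv hW)
  calc ∫ j, ‖descent G η (fun k => z (j k)) (t + 1) - v j‖ ^ 2 ∂(indexLaw m)
      ≤ ∫ j, (‖w j - v j‖ ^ 2 - 2 * η t * (ℓ (z (j t)) (w j) - ℓ (z (j t)) (v j)) +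
          η t ^ 2 * B ^ 2) ∂(indexLaw m) :=
        integral_mono (hsq (by omega)) (((hsq ht).sub (hint.const_mul _)).add
          (integrable_const _)) fun j => norm_sq_descent_succ_sub_le O hη _ ht (v j)
    _ = _ := by
        rw [integral_add (by exact hsqt.sub (hint.const_mul _)) (integrable_const _),
          integral_sub hsqt (hint.const_mul _), integral_const_mul, hlin]
        simp [hwdef]

/-- The one-step inequality telescopes. The comparison point may be random, provided it ignores the
indices from time `s` on, so that `v = w_s` is admissible. -/
theorem sum_mul_empiricalRisk_sub_le [NeZero m] [BorelSpace F] [SecondCountableTopology F]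
    (O : IsNonexpansiveLoss ℓ G M B η₁) (hη : ∀ k, 0 ≤ η k) (z : Fin m → Z) {s t : ℕ} (hs : 1 ≤ s)
    (hst : s ≤ t) {v : (ℕ → Fin m) → F} (hv : Measurable v) {W : ℝ} (hW : ∀ j, ‖v j‖ ≤ W)
    (hinv : ∀ k, s ≤ k → ∀ j x, v (Function.update j k x) = v j) :
    ∑ k ∈ Finset.Ico s (t + 1), η k *
        (∫ j, empiricalRisk ℓ z (descent G η (fun k => z (j k)) k) ∂(indexLaw m) -
          ∫ j, empiricalRisk ℓ z (v j) ∂(indexLaw m)) ≤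
      (∫ j, ‖descent G η (fun k => z (j k)) s - v j‖ ^ 2 ∂(indexLaw m)) / 2 +
        B ^ 2 / 2 * ∑ k ∈ Finset.Ico s (t + 1), η k ^ 2 := by
  have key : ∀ t, s ≤ t → ∑ k ∈ Finset.Ico s t, η k *
        (∫ j, empiricalRisk ℓ z (descent G η (fun k => z (j k)) k) ∂(indexLaw m) -
          ∫ j, empiricalRisk ℓ z (v j) ∂(indexLaw m)) +
        (∫ j, ‖descent G η (fun k => z (j k)) t - v j‖ ^ 2 ∂(indexLaw m)) / 2 ≤
      (∫ j, ‖descent G η (fun k => z (j k)) s - v j‖ ^ 2 ∂(indexLaw m)) / 2 +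
        B ^ 2 / 2 * ∑ k ∈ Finset.Ico s t, η k ^ 2 := by
    intro t hst
    induction t, hst using Nat.le_induction with
    | base => simp
    | succ n hn ih =>
      rw [Finset.sum_Ico_succ_top hn, Finset.sum_Ico_succ_top hn]
      have := integral_norm_sq_descent_succ_le O hη z (hs.trans hn) hv hW (hinv n hn)
      linarith
  have h0 : 0 ≤ ∫ j, ‖descent G η (fun k => z (j k)) (t + 1) - v j‖ ^ 2 ∂(indexLaw m) :=
    integral_nonneg fun j => by positivity
  linarith [key (t + 1) (by omega)]

/-- The optimization error of the averaged iterates. -/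
theorem weighted_average_empiricalRisk_le [NeZero m] [BorelSpace F] [SecondCountableTopology F]
    (O : IsNonexpansiveLoss ℓ G M B η₁) (hη : ∀ k, 0 ≤ η k) (hη₀ : ∀ k, 1 ≤ k → 0 < η k)
    (z : Fin m → Z) {t : ℕ} (ht : 1 ≤ t) (v : F) :
    (∑ k ∈ Finset.Ico 1 (t + 1), η k *
        ∫ j, empiricalRisk ℓ z (descent G η (fun k => z (j k)) k) ∂(indexLaw m) -
        B ^ 2 / 2 * ∑ k ∈ Finset.Ico 1 (t + 1), η k ^ 2) / ∑ k ∈ Finset.Ico 1 (t + 1), η k ≤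
      empiricalRisk ℓ z v + (∑ k ∈ Finset.Ico 1 (t + 1), η k)⁻¹ / 2 * ‖v‖ ^ 2 := by
  have h := sum_mul_empiricalRisk_sub_le O hη z le_rfl ht (v := fun _ => v) measurable_const
    (fun _ => le_rfl) (fun _ _ _ _ => rfl)
  have hA : 0 < ∑ k ∈ Finset.Ico 1 (t + 1), η k :=
    Finset.sum_pos (fun k hk => hη₀ k (by simp at hk; omega)) ⟨1, by simp; omega⟩
  simp only [descent_one, zero_sub, norm_neg, integral_const, probReal_univ, one_smul, mul_sub,
    Finset.sum_sub_distrib, ← Finset.sum_mul] at h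
  rw [div_le_iff₀ hA, add_mul, mul_right_comm, div_mul_eq_mul_div (_⁻¹),
    inv_mul_cancel₀ hA.ne']
  linarith

/-- The optimization error of the last iterate. -/
theorem integral_empiricalRisk_last_le [NeZero m] [BorelSpace F] [SecondCountableTopology F]
    (O : IsNonexpansiveLoss ℓ G M B η₁) (hη : ∀ k, 0 ≤ η k) (hη₀ : ∀ k, 1 ≤ k → 0 < η k)
    (z : Fin m → Z) {t : ℕ} (ht : 1 ≤ t) (v : F) :
    ∫ j, empiricalRisk ℓ z (descent G η (fun k => z (j k)) t) ∂(indexLaw m) ≤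
      empiricalRisk ℓ z v + (∑ k ∈ Finset.Ico 1 (t + 1), η k)⁻¹ / 2 * ‖v‖ ^ 2 +
        B ^ 2 / 2 * (η t +
          ∑ k ∈ Finset.Ico 1 t, η k ^ 2 / ∑ i ∈ Finset.Ico (k + 1) (t + 1), η i) := by
  refine (last_le_weighted_average hη₀ le_rfl ht (c := B ^ 2 / 2)
    (e := fun k => ∫ j, empiricalRisk ℓ z (descent G η (fun k => z (j k)) k) ∂(indexLaw m))
    fun s hs hst => ?_).trans
    (add_le_add (weighted_average_empiricalRisk_le O hη hη₀ z ht v) le_rfl)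
  -- Comparing with the iterate at time `s` itself makes the initial distance zero.
  have := sum_mul_empiricalRisk_sub_le O hη z hs hst
    (v := fun j => descent G η (fun k => z (j k)) s)
    (measurable_descent O (fun k => (measurable_of_finite z).comp (measurable_pi_apply k)) hs)
    (fun j => norm_descent_le O hη _ hs)
    (fun k hk j x => descent_congr G η hs fun l hl => by rw [Function.update_of_ne (by omega)])
  simpa using this

/-- Jensen's inequality reduces this to the weighted average of the risks. The error is then
weakened to that of the last iterate, so that both estimators share one final computation. -/
theorem integral_empiricalRisk_average_le [NeZero m] [BorelSpace F] [SecondCountableTopology F]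
    (O : IsNonexpansiveLoss ℓ G M B η₁) (hη : ∀ k, 0 ≤ η k) (hη₀ : ∀ k, 1 ≤ k → 0 < η k)
    (z : Fin m → Z) {t : ℕ} (ht : 1 ≤ t) (v : F) :
    ∫ j, empiricalRisk ℓ z (∑ k ∈ Finset.Ico 1 (t + 1),
        (η k / ∑ i ∈ Finset.Ico 1 (t + 1), η i) • descent G η (fun k => z (j k)) k)
        ∂(indexLaw m) ≤
      empiricalRisk ℓ z v + (∑ k ∈ Finset.Ico 1 (t + 1), η k)⁻¹ / 2 * ‖v‖ ^ 2 +
        B ^ 2 / 2 * (η t +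
          ∑ k ∈ Finset.Ico 1 t, η k ^ 2 / ∑ i ∈ Finset.Ico (k + 1) (t + 1), η i) := by
  have hAs : ∀ {s}, 1 ≤ s → s ≤ t → 0 < ∑ k ∈ Finset.Ico s (t + 1), η k := fun {s} hs hst =>
    Finset.sum_pos (fun k hk => hη₀ k (by simp at hk; omega)) ⟨s, by simp; omega⟩
  have hA := hAs le_rfl ht
  have havg := weighted_average_empiricalRisk_le O hη hη₀ z ht v
  set A := ∑ k ∈ Finset.Ico 1 (t + 1), η k with hAdef
  have hw : ∀ k ∈ Finset.Ico 1 (t + 1), Measurable fun j : ℕ → Fin m =>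
      descent G η (fun k => z (j k)) k := fun k hk =>
    measurable_descent O (fun k => (measurable_of_finite z).comp (measurable_pi_apply k))
      (Finset.mem_Ico.1 hk).1
  have hint : ∀ k ∈ Finset.Ico 1 (t + 1), Integrable (fun j : ℕ → Fin m =>
      empiricalRisk ℓ z (descent G η (fun k => z (j k)) k)) (indexLaw m) := fun k hk =>
    O.integrable_empiricalRisk (fun _ => measurable_const) (hw k hk)
      (fun j => norm_descent_le O hη _ (Finset.mem_Ico.1 hk).1)
  have hjensen : ∀ w : ℕ → F, empiricalRisk ℓ z (∑ k ∈ Finset.Ico 1 (t + 1), (η k / A) • w k) ≤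
      ∑ k ∈ Finset.Ico 1 (t + 1), (η k / A) * empiricalRisk ℓ z (w k) := by
    intro w
    simp only [empiricalRisk, mul_left_comm _ ((m : ℝ)⁻¹)]
    rw [← Finset.mul_sum]
    refine mul_le_mul_of_nonneg_left ?_ (by positivity)
    simp only [Finset.mul_sum]
    rw [Finset.sum_comm]
    refine Finset.sum_le_sum fun i _ => O.loss_sum_le _ _
      (fun k _ => div_nonneg (hη k) hA.le) ?_ _
    rw [← Finset.sum_div, ← hAdef, div_self hA.ne']
  have hle : ∫ j, empiricalRisk ℓ z (∑ k ∈ Finset.Ico 1 (t + 1),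
        (η k / A) • descent G η (fun k => z (j k)) k) ∂(indexLaw m) ≤
      (∑ k ∈ Finset.Ico 1 (t + 1), η k *
        ∫ j, empiricalRisk ℓ z (descent G η (fun k => z (j k)) k) ∂(indexLaw m)) / A := by
    have hnorm : ∀ j : ℕ → Fin m, ‖∑ k ∈ Finset.Ico 1 (t + 1),
        (η k / A) • descent G η (fun k => z (j k)) k‖ ≤
        ∑ k ∈ Finset.Ico 1 (t + 1), η k / A * ∑ i ∈ Finset.Ico 1 k, η i * B := fun j => by
      refine norm_sum_le_of_le _ fun k hk => ?_
      rw [norm_smul, Real.norm_of_nonneg (div_nonneg (hη k) hA.le)]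
      exact mul_le_mul_of_nonneg_left (norm_descent_le O hη _ (Finset.mem_Ico.1 hk).1)
        (div_nonneg (hη k) hA.le)
    have hmeas : Measurable fun j : ℕ → Fin m => ∑ k ∈ Finset.Ico 1 (t + 1),
        (η k / A) • descent G η (fun k => z (j k)) k :=
      Finset.measurable_fun_sum _ fun k hk => (hw k hk).const_smul (η k / A)
    have hint' : Integrable (fun j : ℕ → Fin m => empiricalRisk ℓ z
        (∑ k ∈ Finset.Ico 1 (t + 1), (η k / A) • descent G η (fun k => z (j k)) k))
        (indexLaw m) :=
      O.integrable_empiricalRisk (z := fun _ => z) (fun _ => measurable_const) hmeas hnorm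
    calc _ ≤ ∫ j, ∑ k ∈ Finset.Ico 1 (t + 1),
          (η k / A) * empiricalRisk ℓ z (descent G η (fun k => z (j k)) k) ∂(indexLaw m) :=
          integral_mono hint' (integrable_finsetSum _ fun k hk => (hint k hk).const_mul _)
            fun j => hjensen _
      _ = _ := by
          rw [integral_finsetSum _ fun k hk => (hint k hk).const_mul _, Finset.sum_div]
          exact Finset.sum_congr rfl fun k _ => by rw [integral_const_mul, div_mul_eq_mul_div]
  have hQ : (∑ k ∈ Finset.Ico 1 (t + 1), η k ^ 2) / A ≤ η t +
      ∑ k ∈ Finset.Ico 1 t, η k ^ 2 / ∑ i ∈ Finset.Ico (k + 1) (t + 1), η i := by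
    rw [Finset.sum_Ico_succ_top ht, add_div, add_comm, Finset.sum_div]
    refine add_le_add ?_ (Finset.sum_le_sum fun k hk => ?_)
    · rw [div_le_iff₀ hA, sq]
      exact mul_le_mul_of_nonneg_left (Finset.single_le_sum (f := η) (fun k _ => hη k)
        (by simp; omega)) (hη t)
    · simp only [Finset.mem_Ico] at hk
      refine div_le_div_of_nonneg_left (sq_nonneg _) (hAs (by omega) (by omega)) ?_
      exact Finset.sum_le_sum_of_subset_of_nonneg (Finset.Ico_subset_Ico_left (by omega))
        fun k _ _ => hη k
  rw [sub_div, mul_div_assoc] at havg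
  linarith [mul_le_mul_of_nonneg_left hQ (by positivity : 0 ≤ B ^ 2 / 2)]

/-- Algorithmic stability bounds the generalization error. -/
theorem integral_risk_le_of_stable [NeZero m] (O : IsNonexpansiveLoss ℓ G M B η₁)
    (ρ : Measure Z) [IsProbabilityMeasure ρ] {g : (Fin m → Z) → F} (hg : Measurable g) {W : ℝ}
    (hW : ∀ z, ‖g z‖ ≤ W) {d : Fin m → ℝ}
    (hd : ∀ z i x, ‖g z - g (Function.update z i x)‖ ≤ d i) :
    ∫ z, ∫ p, ℓ p (g z) ∂ρ ∂(Measure.pi fun _ : Fin m => ρ) ≤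
      ∫ z, empiricalRisk ℓ z (g z) ∂(Measure.pi fun _ : Fin m => ρ) +
        (m : ℝ)⁻¹ * (B * ∑ i, d i) := by
  have hm : (m : ℝ) ≠ 0 := NeZero.ne _
  have hB : 0 ≤ B := by
    obtain ⟨p⟩ := nonempty_of_isProbabilityMeasure ρ
    exact (norm_nonneg _).trans (O.norm_grad_le p 0)
  set P : Measure (Fin m → Z) := Measure.pi fun _ => ρ with hP
  have hprod : ∀ {f : (Fin m → Z) → Z → F}, Measurable (Function.uncurry f) →
      (∀ z p, ‖f z p‖ ≤ W) → Integrable (fun z => ∫ p, ℓ p (f z p) ∂ρ) P := fun {f} hf hfW =>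
    (O.integrable_comp (μ := P.prod ρ) (p := Prod.snd) (g := Function.uncurry f)
      measurable_snd hf fun q => hfW q.1 q.2).integral_prod_left
  have key : ∀ i, ∫ z, ∫ p, ℓ p (g z) ∂ρ ∂P ≤ ∫ z, ℓ (z i) (g z) ∂P + B * d i := by
    intro i
    -- After resampling coordinate `i`, the training loss at `z i` is a loss at the fresh point `p`,
    -- for an estimator within `d i` of `g z`.
    have hres : ∫ z, ℓ (z i) (g z) ∂P = ∫ z, ∫ p, ℓ p (g (Function.update z i p)) ∂ρ ∂P := by
      rw [hP, ← Measure.infinitePi_eq_pi, integral_infinitePi_update ρ i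
        (O.measurable_comp (measurable_pi_apply i) hg) fun z => O.abs_le _ (hW z)]
      simp only [Function.update_self]
    have hup : ∀ z, Measurable fun p => g (Function.update z i p) := fun z =>
      hg.comp (measurable_update z)
    have hint : Integrable (fun z => ∫ p, ℓ p (g (Function.update z i p)) ∂ρ) P :=
      hprod (hg.comp (measurable_update_prod i)) fun z p => hW _
    have hmono := integral_mono (μ := P) (hprod (f := fun z _ => g z) (hg.comp measurable_fst)
      fun z p => hW z) (hint.add (integrable_const (B * d i))) fun z => by
        have := integral_mono (μ := ρ) (O.integrable_comp (g := fun _ => g z) measurable_id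
          measurable_const fun _ => hW z) ((O.integrable_comp measurable_id (hup z)
            fun _ => hW _).add (integrable_const (B * d i))) fun p => by
            have h1 := (abs_sub_le_iff.1 (O.abs_sub_le p (g z) (g (Function.update z i p)))).1
            have h2 := mul_le_mul_of_nonneg_left (hd z i p) hB
            simp only [id, Pi.add_apply]
            linarith
        simp only [Pi.add_apply] at this ⊢
        rw [integral_add (O.integrable_comp measurable_id (hup z) fun _ => hW _)
          (integrable_const _)] at this
        simpa using this
    rw [hres]
    simp only [Pi.add_apply] at hmono
    rw [integral_add hint (integrable_const _)] at hmono
    simpa using hmono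
  have hsum := Finset.sum_le_sum fun (i : Fin m) (_ : i ∈ Finset.univ) => key i
  rw [Finset.sum_add_distrib, ← Finset.mul_sum, Finset.sum_const, Finset.card_univ,
    Fintype.card_fin, nsmul_eq_mul] at hsum
  have hemp : ∫ z, empiricalRisk ℓ z (g z) ∂P = (m : ℝ)⁻¹ * ∑ i, ∫ z, ℓ (z i) (g z) ∂P := by
    simp only [empiricalRisk]
    rw [integral_const_mul, integral_finsetSum _ fun i _ =>
      O.integrable_comp (measurable_pi_apply i) hg hW]
  rw [hemp, ← mul_add, ← div_eq_inv_mul, le_div_iff₀ (by positivity)]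
  linarith

theorem integral_empiricalRisk_const [NeZero m] (O : IsNonexpansiveLoss ℓ G M B η₁)
    (ρ : Measure Z) [IsProbabilityMeasure ρ] (w : F) :
    ∫ z, empiricalRisk ℓ z w ∂(Measure.pi fun _ : Fin m => ρ) = ∫ p, ℓ p w ∂ρ := by
  have h : ∀ i : Fin m, ∫ z : Fin m → Z, ℓ (z i) w ∂(Measure.pi fun _ => ρ) = ∫ p, ℓ p w ∂ρ := by
    intro i
    have hp := measurePreserving_eval (fun _ : Fin m => ρ) i
    conv_rhs => rw [← hp.map_eq]
    exact (integral_map hp.measurable.aemeasurable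
      (O.measurable_comp measurable_id measurable_const).aestronglyMeasurable).symm
  simp only [empiricalRisk]
  rw [integral_const_mul, integral_finsetSum _ fun i _ =>
    O.integrable_comp (g := fun _ => w) (measurable_pi_apply i) measurable_const fun _ => le_rfl]
  simp [h, NeZero.ne]

/-- The expected risk of a stable estimator with controlled optimization error. -/
theorem expected_risk_le [NeZero m] (O : IsNonexpansiveLoss ℓ G M B η₁)
    (ρ : Measure Z) [IsProbabilityMeasure ρ] {g : (Fin m → Z) → (ℕ → Fin m) → F}
    (hg : Measurable (Function.uncurry g)) {W : ℝ} (hW : ∀ z j, ‖g z j‖ ≤ W) {t : ℕ}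
    (hstab : ∀ z j i x, ‖g z j - g (Function.update z i x) j‖ ≤
      ∑ k ∈ Finset.Ico 1 t, if j k = i then 2 * B * η k else 0)
    {w : F} {r : ℝ} (hopt : ∀ z, ∫ j, empiricalRisk ℓ z (g z j) ∂(indexLaw m) ≤
      empiricalRisk ℓ z w + r) :
    Integrable (fun q : (Fin m → Z) × (ℕ → Fin m) => ∫ p, ℓ p (g q.1 q.2) ∂ρ)
      ((Measure.pi fun _ => ρ).prod (indexLaw m)) ∧
    ∫ z, ∫ j, ∫ p, ℓ p (g z j) ∂ρ ∂(indexLaw m) ∂(Measure.pi fun _ : Fin m => ρ) ≤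
      ∫ p, ℓ p w ∂ρ + r + (m : ℝ)⁻¹ * (2 * B ^ 2 * ∑ k ∈ Finset.Ico 1 t, η k) := by
  set P : Measure (Fin m → Z) := Measure.pi fun _ => ρ with hP
  have hint : Integrable (fun q : (Fin m → Z) × (ℕ → Fin m) => ∫ p, ℓ p (g q.1 q.2) ∂ρ)
      (P.prod (indexLaw m)) :=
    (O.integrable_comp (μ := (P.prod (indexLaw m)).prod ρ) (p := Prod.snd)
      (g := fun q => g q.1.1 q.1.2) measurable_snd (hg.comp measurable_fst)
      fun q => hW _ _).integral_prod_left
  have hemp : Integrable (fun q : (Fin m → Z) × (ℕ → Fin m) =>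
      empiricalRisk ℓ q.1 (g q.1 q.2)) (P.prod (indexLaw m)) :=
    O.integrable_empiricalRisk (fun i => (measurable_pi_apply i).comp measurable_fst) hg
      fun q => hW _ _
  refine ⟨hint, ?_⟩
  -- Stability is used for fixed indices, the optimization bound for a fixed sample; hence the
  -- exchange of integrals here and back again below.
  rw [integral_integral_swap hint]
  have hgen : ∀ j, ∫ z, ∫ p, ℓ p (g z j) ∂ρ ∂P ≤ ∫ z, empiricalRisk ℓ z (g z j) ∂P +
      (m : ℝ)⁻¹ * (2 * B ^ 2 * ∑ k ∈ Finset.Ico 1 t, η k) := by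
    intro j
    refine (integral_risk_le_of_stable O ρ (g := fun z => g z j)
      (hg.comp (measurable_id.prodMk measurable_const)) (fun z => hW z j) fun z i x => hstab z j i x).trans_eq ?_
    -- Each time `k` draws exactly one sample point, so the sum over `i` is `∑ 2 B η_k` for every
    -- index sequence, with no averaging over `j`.
    rw [Finset.sum_comm]
    simp only [Finset.sum_ite_eq, Finset.mem_univ, if_true, ← Finset.mul_sum, hP]
    ring
  calc ∫ j, ∫ z, ∫ p, ℓ p (g z j) ∂ρ ∂P ∂(indexLaw m)
      ≤ ∫ j, (∫ z, empiricalRisk ℓ z (g z j) ∂P +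
          (m : ℝ)⁻¹ * (2 * B ^ 2 * ∑ k ∈ Finset.Ico 1 t, η k)) ∂(indexLaw m) :=
        integral_mono hint.integral_prod_right (hemp.integral_prod_right.add (integrable_const _))
          hgen
    _ = ∫ z, ∫ j, empiricalRisk ℓ z (g z j) ∂(indexLaw m) ∂P +
          (m : ℝ)⁻¹ * (2 * B ^ 2 * ∑ k ∈ Finset.Ico 1 t, η k) := by
        rw [integral_add hemp.integral_prod_right (integrable_const _),
          integral_integral_swap (f := fun z j => empiricalRisk ℓ z (g z j)) hemp]
        simp
    _ ≤ _ := by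
        gcongr
        have hw : Integrable (fun z => empiricalRisk ℓ z w) P :=
          O.integrable_empiricalRisk (g := fun _ => w) (fun i => measurable_pi_apply i)
            measurable_const fun _ => le_rfl
        refine (integral_mono hemp.integral_prod_left (hw.add (integrable_const r)) hopt).trans_eq ?_
        simp only [Pi.add_apply]
        rw [integral_add hw (integrable_const _), integral_empiricalRisk_const O]
        simp

end Risk

/-! ### The loss of a linear predictor satisfies the abstract hypotheses. -/

section Loss

variable {X F : Type*} [MeasurableSpace X] [NormedAddCommGroup F] [InnerProductSpace ℝ F]
  {Y : Set ℝ} {V : ℝ → ℝ → ℝ} {Φ : X → F} {L κ a₀ η₁ : ℝ}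

theorem SmoothnessAssumption.hasDerivAt (hS : SmoothnessAssumption Y V L) {y : ℝ} (hy : y ∈ Y)
    (a : ℝ) : HasDerivAt (V y) (lossLeftDeriv V y a) a := by
  have h := hS.differentiable y hy a
  rw [lossLeftDeriv, h.derivWithin (uniqueDiffWithinAt_Iio a)]
  exact h.hasDerivAt

theorem sub_le_mul_of_convexOn_of_hasDerivAt {f : ℝ → ℝ} (hf : ConvexOn ℝ Set.univ f) {a b f' : ℝ}
    (h : HasDerivAt f f' a) : f a - f b ≤ f' * (a - b) := by
  rcases lt_trichotomy a b with hab | rfl | hab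
  · have := hf.le_slope_of_hasDerivAt (Set.mem_univ a) (Set.mem_univ b) hab h
    rw [slope_def_field, le_div_iff₀ (sub_pos.2 hab)] at this
    linarith
  · simp
  · have := hf.slope_le_of_hasDerivAt (Set.mem_univ b) (Set.mem_univ a) hab h
    rw [slope_def_field, div_le_iff₀ (sub_pos.2 hab)] at this
    linarith

/-- Differentiability lets the left derivative be computed as a limit of right difference quotients
along `1 / (n + 1)`, which are jointly measurable. -/
theorem measurable_lossLeftDeriv (hV : Measurable (Function.uncurry V))
    (hS : SmoothnessAssumption Y V L) :
    Measurable fun q : Y × ℝ => lossLeftDeriv V q.1 q.2 := by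
  have hV' : ∀ {f : Y × ℝ → ℝ}, Measurable f → Measurable fun q => V q.1 (f q) := fun hf =>
    hV.comp ((measurable_subtype_coe.comp measurable_fst).prodMk hf)
  refine measurable_of_tendsto_metrizable (f := fun (n : ℕ) (q : Y × ℝ) =>
    ((1 : ℝ) / (n + 1))⁻¹ • (V q.1 (q.2 + 1 / (n + 1)) - V q.1 q.2)) (fun n => ?_) ?_
  · exact ((hV' (measurable_snd.add_const _)).sub (hV' measurable_snd)).const_smul
      ((1 : ℝ) / ((n : ℝ) + 1))⁻¹
  · refine tendsto_pi_nhds.2 fun q => ?_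
    have h := hasDerivAt_iff_tendsto_slope_zero.1 (hS.hasDerivAt q.1.2 q.2)
    refine h.comp (tendsto_nhdsWithin_iff.2
      ⟨tendsto_one_div_add_atTop_nhds_zero_nat, .of_forall fun n => ?_⟩)
    have : (0 : ℝ) < 1 / ((n : ℝ) + 1) := by positivity
    exact this.ne'

/-- The loss of a linear predictor on the features. -/
noncomputable def featureLoss (V : ℝ → ℝ → ℝ) (Φ : X → F) (p : X × Y) (w : F) : ℝ :=
  V p.2 (inner ℝ w (Φ p.1))

/-- The gradient of `featureLoss` in the predictor. -/
noncomputable def featureGrad (V : ℝ → ℝ → ℝ) (Φ : X → F) (p : X × Y) (w : F) : F :=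
  lossLeftDeriv V p.2 (inner ℝ w (Φ p.1)) • Φ p.1

/-- Here `u` is a difference of predictors and `δ` the corresponding difference of loss derivatives.
Monotonicity and the Lipschitz bound give co-coercivity `δ² ≤ L δ s`, so the square of the left side
is at most `‖u‖² - c δ s (2 - c κ² L)`. -/
theorem norm_sub_smul_le {u φ : F} {c δ s L κ η₁ : ℝ} (hs : inner ℝ u φ = s) (hδ : 0 ≤ δ * s)
    (hL : 0 < L) (hδL : |δ| ≤ L * |s|) (hφ : ‖φ‖ ≤ κ) (hc : 0 ≤ c) (hcη : c ≤ η₁)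
    (hη : η₁ * (κ ^ 2 * L) ≤ 2) : ‖u - (c * δ) • φ‖ ≤ ‖u‖ := by
  have hδ2 : δ ^ 2 ≤ L * (δ * s) := by
    rw [← sq_abs, ← abs_of_nonneg hδ, abs_mul]
    nlinarith [abs_nonneg δ]
  have hcκ : c * (κ ^ 2 * L) ≤ 2 :=
    (mul_le_mul_of_nonneg_right hcη (by positivity)).trans hη
  have hφ2 : ‖φ‖ ^ 2 ≤ κ ^ 2 := pow_le_pow_left₀ (norm_nonneg _) hφ 2
  have h1 : c ^ 2 * (δ ^ 2 * ‖φ‖ ^ 2) ≤ c ^ 2 * (L * (δ * s) * κ ^ 2) := by gcongr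
  have h2 := mul_le_mul_of_nonneg_right hcκ (mul_nonneg hc hδ)
  refine (pow_le_pow_iff_left₀ (norm_nonneg _) (norm_nonneg _) two_ne_zero).1 ?_
  rw [norm_sub_sq_real, inner_smul_right, hs, norm_smul, mul_pow, Real.norm_eq_abs, sq_abs]
  linarith

theorem isNonexpansiveLoss_featureLoss [MeasurableSpace F] [BorelSpace F]
    [SecondCountableTopology F] (hV : Measurable (Function.uncurry V)) (hV₀ : ∀ y a, 0 ≤ V y a)
    (hΦ : Measurable Φ) (hB : BoundednessAssumption Y V Φ κ a₀) (hS : SmoothnessAssumption Y V L)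
    (hη : η₁ * (κ ^ 2 * L) ≤ 2) :
    ∃ M, IsNonexpansiveLoss (featureLoss (Y := Y) V Φ) (featureGrad V Φ) M (a₀ * κ) η₁ := by
  obtain ⟨M, hM⟩ := hB.bddAbove_zero
  have hΦκ : ∀ x, ‖Φ x‖ ≤ κ := fun x => hB.isLUB_feature.1 ⟨x, rfl⟩
  have hin : Measurable fun q : (X × Y) × F => (inner ℝ q.2 (Φ q.1.1) : ℝ) :=
    measurable_snd.inner (hΦ.comp (measurable_fst.comp measurable_fst))
  have hy : Measurable fun q : (X × Y) × F => q.1.2 := measurable_snd.comp measurable_fst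
  have hsub : ∀ (p : X × Y) (a b : ℝ), V p.2 a - V p.2 b ≤ lossLeftDeriv V p.2 a * (a - b) :=
    fun p a b => sub_le_mul_of_convexOn_of_hasDerivAt (hB.convex p.2 p.2.2) (hS.hasDerivAt p.2.2 a)
  refine ⟨M, ⟨hV.comp ((measurable_subtype_coe.comp hy).prodMk hin), ?_, fun p w => hV₀ _ _,
    fun p => ?_, fun p w => ?_, fun p w v => ?_, fun p w v c hc hcη => ?_⟩⟩
  · exact ((measurable_lossLeftDeriv hV hS).comp (hy.prodMk hin)).smul
      (hΦ.comp (measurable_fst.comp measurable_fst))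
  · simpa [featureLoss] using hM ⟨p.2, p.2.2, rfl⟩
  · rw [featureGrad, norm_smul, Real.norm_eq_abs]
    have ha := hB.abs_leftDeriv_le p.2 p.2.2 (inner ℝ w (Φ p.1))
    exact mul_le_mul ha (hΦκ _) (norm_nonneg _) ((abs_nonneg _).trans ha)
  · refine (hsub p _ _).trans_eq ?_
    rw [featureGrad, real_inner_smul_left, real_inner_comm, inner_sub_right, real_inner_comm w,
      real_inner_comm v]
  · have hlip := hS.lipschitz_deriv p.2 p.2.2 (inner ℝ v (Φ p.1)) (inner ℝ w (Φ p.1))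
    rw [(hS.hasDerivAt p.2.2 _).deriv, (hS.hasDerivAt p.2.2 _).deriv] at hlip
    have hrw : (w - c • featureGrad V Φ p w) - (v - c • featureGrad V Φ p v) = (w - v) -
        (c * (lossLeftDeriv V p.2 (inner ℝ w (Φ p.1)) -
          lossLeftDeriv V p.2 (inner ℝ v (Φ p.1)))) • Φ p.1 := by
      simp only [featureGrad]
      module
    rw [hrw]
    refine norm_sub_smul_le (inner_sub_left w v (Φ p.1)) ?_ hS.pos hlip (hΦκ _) hc hcη hη
    -- Adding the two subgradient inequalities gives monotonicity of the derivative.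
    linarith [hsub p (inner ℝ w (Φ p.1)) (inner ℝ v (Φ p.1)),
      hsub p (inner ℝ v (Φ p.1)) (inner ℝ w (Φ p.1))]

end Loss

/-! ### Identification of the concrete iterates with the abstract descent. -/

section Iterates

variable {X F : Type*} [NormedAddCommGroup F] [InnerProductSpace ℝ F] {Y : Set ℝ}
  {V : ℝ → ℝ → ℝ} {Φ : X → F}

theorem iterate_eq_descent {m : ℕ} (η : ℕ → ℝ) (z : Fin m → X × Y) (j : ℕ → Fin m) (t : ℕ) :
    iterate V Φ η z j t = descent (featureGrad V Φ) η (fun k => z (j k)) t := by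
  induction t using Nat.twoStepInduction with
  | zero => rfl
  | one => rfl
  | more t _ ih => rw [iterate, descent, ih, featureGrad, smul_smul]

theorem averagedIterate_eq_sum {m : ℕ} (η : ℕ → ℝ) (z : Fin m → X × Y) (j : ℕ → Fin m) (t : ℕ) :
    averagedIterate V Φ η z j t = ∑ k ∈ Finset.Ico 1 (t + 1),
      (η k / ∑ i ∈ Finset.Ico 1 (t + 1), η i) •
        descent (featureGrad V Φ) η (fun k => z (j k)) k := by
  rw [averagedIterate, Finset.smul_sum, Finset.Ico_add_one_right_eq_Icc]
  refine Finset.sum_congr rfl fun k _ => ?_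
  rw [iterate_eq_descent, smul_smul, div_eq_inv_mul]

end Iterates

/-! ### Expected risk of the last and of the averaged iterate. -/

section Estimator

variable {Z F : Type*} [MeasurableSpace Z] [NormedAddCommGroup F] [InnerProductSpace ℝ F]
  [MeasurableSpace F] {ℓ : Z → F → ℝ} {G : Z → F → F} {M B η₁ : ℝ} {η : ℕ → ℝ} {m : ℕ}

theorem measurable_descent_sample [NeZero m] [BorelSpace F] [SecondCountableTopology F]
    (O : IsNonexpansiveLoss ℓ G M B η₁) {t : ℕ} (ht : 1 ≤ t) :
    Measurable fun q : (Fin m → Z) × (ℕ → Fin m) => descent G η (fun k => q.1 (q.2 k)) t := by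
  refine measurable_descent O (fun k => ?_) ht
  have : Measurable fun q : (Fin m → Z) × Fin m => q.1 q.2 :=
    measurable_from_prod_countable_left fun i => measurable_pi_apply i
  exact this.comp (measurable_fst.prodMk ((measurable_pi_apply k).comp measurable_snd))

theorem norm_descent_sub_update_le (O : IsNonexpansiveLoss ℓ G M B η₁) (hη : ∀ k, 0 ≤ η k)
    (hη' : ∀ k, 1 ≤ k → η k ≤ η₁) (z : Fin m → Z) (j : ℕ → Fin m) (i : Fin m) (x : Z) {t : ℕ}
    (ht : 1 ≤ t) :
    ‖descent G η (fun k => z (j k)) t - descent G η (fun k => Function.update z i x (j k)) t‖ ≤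
      ∑ k ∈ Finset.Ico 1 t, if j k = i then 2 * B * η k else 0 :=
  norm_descent_sub_descent_le O hη hη' (fun k => j k = i)
    (fun k hk => by rw [Function.update_of_ne hk]) ht

theorem sum_ite_mono (hB : 0 ≤ B) (hη : ∀ k, 0 ≤ η k) (j : ℕ → Fin m) (i : Fin m) {s t : ℕ}
    (hst : s ≤ t) : (∑ k ∈ Finset.Ico 1 s, if j k = i then 2 * B * η k else 0) ≤
      ∑ k ∈ Finset.Ico 1 t, if j k = i then 2 * B * η k else 0 :=
  Finset.sum_le_sum_of_subset_of_nonneg (Finset.Ico_subset_Ico_right hst) fun k _ _ => by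
    have := hη k
    positivity

theorem expected_risk_last_le [NeZero m] [BorelSpace F] [SecondCountableTopology F]
    (O : IsNonexpansiveLoss ℓ G M B η₁) (hη : ∀ k, 0 ≤ η k) (hη₀ : ∀ k, 1 ≤ k → 0 < η k)
    (hη' : ∀ k, 1 ≤ k → η k ≤ η₁) (ρ : Measure Z) [IsProbabilityMeasure ρ] {t : ℕ} (ht : 1 ≤ t)
    (w : F) :
    Integrable (fun q : (Fin m → Z) × (ℕ → Fin m) =>
      ∫ p, ℓ p (descent G η (fun k => q.1 (q.2 k)) t) ∂ρ)
      ((Measure.pi fun _ => ρ).prod (indexLaw m)) ∧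
    ∫ z, ∫ j, ∫ p, ℓ p (descent G η (fun k => z (j k)) t) ∂ρ ∂(indexLaw m)
        ∂(Measure.pi fun _ : Fin m => ρ) ≤
      ∫ p, ℓ p w ∂ρ + ((∑ k ∈ Finset.Ico 1 (t + 1), η k)⁻¹ / 2 * ‖w‖ ^ 2 + B ^ 2 / 2 * (η t +
          ∑ k ∈ Finset.Ico 1 t, η k ^ 2 / ∑ i ∈ Finset.Ico (k + 1) (t + 1), η i)) +
        (m : ℝ)⁻¹ * (2 * B ^ 2 * ∑ k ∈ Finset.Ico 1 t, η k) :=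
  expected_risk_le O ρ (g := fun z j => descent G η (fun k => z (j k)) t)
    (measurable_descent_sample O ht) (fun _ _ => norm_descent_le O hη _ ht)
    (fun z j i x => norm_descent_sub_update_le O hη hη' z j i x ht)
    fun z => (integral_empiricalRisk_last_le O hη hη₀ z ht w).trans_eq (add_assoc _ _ _)

/-- The stability bounds of the iterates increase with time and the weights sum to 1, so the average
is as stable as the last iterate. -/
theorem expected_risk_average_le [NeZero m] [BorelSpace F] [SecondCountableTopology F]
    (O : IsNonexpansiveLoss ℓ G M B η₁) (hη : ∀ k, 0 ≤ η k) (hη₀ : ∀ k, 1 ≤ k → 0 < η k)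
    (hη' : ∀ k, 1 ≤ k → η k ≤ η₁) (ρ : Measure Z) [IsProbabilityMeasure ρ] {t : ℕ} (ht : 1 ≤ t)
    (w : F) :
    Integrable (fun q : (Fin m → Z) × (ℕ → Fin m) =>
      ∫ p, ℓ p (∑ k ∈ Finset.Ico 1 (t + 1), (η k / ∑ i ∈ Finset.Ico 1 (t + 1), η i) •
        descent G η (fun k => q.1 (q.2 k)) k) ∂ρ)
      ((Measure.pi fun _ => ρ).prod (indexLaw m)) ∧
    ∫ z, ∫ j, ∫ p, ℓ p (∑ k ∈ Finset.Ico 1 (t + 1), (η k / ∑ i ∈ Finset.Ico 1 (t + 1), η i) •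
        descent G η (fun k => z (j k)) k) ∂ρ ∂(indexLaw m) ∂(Measure.pi fun _ : Fin m => ρ) ≤
      ∫ p, ℓ p w ∂ρ + ((∑ k ∈ Finset.Ico 1 (t + 1), η k)⁻¹ / 2 * ‖w‖ ^ 2 + B ^ 2 / 2 * (η t +
          ∑ k ∈ Finset.Ico 1 t, η k ^ 2 / ∑ i ∈ Finset.Ico (k + 1) (t + 1), η i)) +
        (m : ℝ)⁻¹ * (2 * B ^ 2 * ∑ k ∈ Finset.Ico 1 t, η k) := by
  have hopt := fun z : Fin m → Z => (integral_empiricalRisk_average_le O hη hη₀ z ht w).trans_eq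
    (add_assoc _ _ _)
  have hA : 0 < ∑ k ∈ Finset.Ico 1 (t + 1), η k :=
    Finset.sum_pos (fun k hk => hη₀ k (by simp at hk; omega)) ⟨1, by simp; omega⟩
  have hB : 0 ≤ B := by
    obtain ⟨p⟩ := nonempty_of_isProbabilityMeasure ρ
    exact (norm_nonneg _).trans (O.norm_grad_le p 0)
  have hsum : ∑ k ∈ Finset.Ico 1 (t + 1), η k / ∑ i ∈ Finset.Ico 1 (t + 1), η i = 1 := by
    rw [← Finset.sum_div, div_self hA.ne']
  set A := ∑ k ∈ Finset.Ico 1 (t + 1), η k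
  have ha : ∀ k, 0 ≤ η k / A := fun k => div_nonneg (hη k) hA.le
  refine expected_risk_le O ρ (g := fun z j => ∑ k ∈ Finset.Ico 1 (t + 1),
    (η k / A) • descent G η (fun k => z (j k)) k)
    (W := ∑ k ∈ Finset.Ico 1 (t + 1), η k / A * ∑ i ∈ Finset.Ico 1 k, η i * B)
    (Finset.measurable_fun_sum _ fun k hk =>
      (measurable_descent_sample O (Finset.mem_Ico.1 hk).1).const_smul (η k / A))
    (fun _ _ => norm_sum_le_of_le _ fun k hk => ?_) (fun z j i x => ?_) hopt
  · rw [norm_smul, Real.norm_of_nonneg (ha k)]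
    exact mul_le_mul_of_nonneg_left (norm_descent_le O hη _ (Finset.mem_Ico.1 hk).1) (ha k)
  · rw [← Finset.sum_sub_distrib]
    calc _ ≤ ∑ k ∈ Finset.Ico 1 (t + 1), η k / A *
          ∑ k ∈ Finset.Ico 1 t, if j k = i then 2 * B * η k else 0 := by
          refine norm_sum_le_of_le _ fun k hk => ?_
          simp only [Finset.mem_Ico] at hk
          rw [← smul_sub, norm_smul, Real.norm_of_nonneg (ha k)]
          exact mul_le_mul_of_nonneg_left ((norm_descent_sub_update_le O hη hη' z j i x hk.1).trans
            (sum_ite_mono hB hη j i (by omega))) (ha k)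
      _ = _ := by rw [← Finset.sum_mul, hsum, one_mul]

end Estimator

/-! ### From comparison with every predictor to excess risk. -/

section Excess

variable {X F : Type*} [MeasurableSpace X] [NormedAddCommGroup F] [InnerProductSpace ℝ F]
  {Y : Set ℝ} {V : ℝ → ℝ → ℝ} {Φ : X → F}

/-- The left side does not depend on `w`, so the infimum over `w` may be taken; no minimizer of the
risk is needed. -/
theorem expectedExcessRiskLE_of_forall_risk_le (ρ : Measure (X × Y)) [IsProbabilityMeasure ρ]
    {m : ℕ} [NeZero m] {g : (Fin m → X × Y) → (ℕ → Fin m) → F} {lam r : ℝ}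
    (h : ∀ w, Integrable (fun q : (Fin m → X × Y) × (ℕ → Fin m) => risk ρ V Φ (g q.1 q.2))
        ((sampleLaw ρ m).prod (indexLaw m)) ∧
      ∫ z, ∫ j, risk ρ V Φ (g z j) ∂(indexLaw m) ∂(sampleLaw ρ m) ≤
        risk ρ V Φ w + lam / 2 * ‖w‖ ^ 2 + r) :
    ExpectedExcessRiskLE ρ V Φ m g (approxError ρ V Φ lam + r) := by
  have : IsProbabilityMeasure (sampleLaw ρ m) := by
    unfold sampleLaw
    infer_instance
  have hint := (h 0).1
  have hint' : Integrable (fun q : (Fin m → X × Y) × (ℕ → Fin m) =>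
      excessRisk ρ V Φ (g q.1 q.2)) ((sampleLaw ρ m).prod (indexLaw m)) :=
    hint.sub (integrable_const _)
  refine ⟨hint', ?_⟩
  have hle : ∫ z, ∫ j, risk ρ V Φ (g z j) ∂(indexLaw m) ∂(sampleLaw ρ m) - r ≤
      ⨅ w : F, (risk ρ V Φ w + lam / 2 * ‖w‖ ^ 2) :=
    le_ciInf fun w => by linarith [(h w).2]
  rw [integral_integral (f := fun z j => risk ρ V Φ (g z j)) hint] at hle
  rw [integral_integral (f := fun z j => excessRisk ρ V Φ (g z j)) hint']
  simp only [excessRisk, approxError]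
  rw [integral_sub hint (integrable_const _)]
  simp only [integral_const, probReal_univ, one_smul]
  linarith

theorem ExpectedExcessRiskLE.mono {ρ : Measure (X × Y)} {m : ℕ} [NeZero m]
    {g : (Fin m → X × Y) → (ℕ → Fin m) → F} {b c : ℝ} (h : ExpectedExcessRiskLE ρ V Φ m g b)
    (hbc : b ≤ c) : ExpectedExcessRiskLE ρ V Φ m g c :=
  ⟨h.1, h.2.trans hbc⟩

/-- The bound for both estimators, at every time. -/
theorem expectedExcessRiskLE_stochasticGradient [CompleteSpace F]
    [TopologicalSpace.SeparableSpace F] [MeasurableSpace F] [BorelSpace F]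
    {β cβ κ a₀ η₁ L : ℝ} (hβ₀ : 0 < β) (hβ₁ : β ≤ 1) (hcβ : 0 < cβ) (hη₁ : 0 < η₁)
    {ρ : Measure (X × Y)} [IsProbabilityMeasure ρ] (hV : Measurable (Function.uncurry V))
    (hV₀ : ∀ y a, 0 ≤ V y a) (hΦ : Measurable Φ) (hB : BoundednessAssumption Y V Φ κ a₀)
    (hA : ApproximationAssumption ρ V Φ β cβ) (hS : SmoothnessAssumption Y V L)
    (hη : η₁ * (κ ^ 2 * L) ≤ 2) {m : ℕ} [NeZero m] {t : ℕ} (ht : 1 ≤ t)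
    {g : (Fin m → X × Y) → (ℕ → Fin m) → F}
    (hg : g = (fun z j => averagedIterate V Φ (stepSize η₁ β) z j t) ∨
      g = (fun z j => iterate V Φ (stepSize η₁ β) z j t)) :
    ExpectedExcessRiskLE ρ V Φ m g ((cβ * η₁ ^ (-β) + 4 * (a₀ * κ) ^ 2 * η₁) *
      ((m : ℝ)⁻¹ * ((t : ℝ) ^ (1 / (β + 1)) * Real.log t)
        + (t : ℝ) ^ (-(β / (β + 1))) * Real.log t + (t : ℝ) ^ (-(β / (β + 1))))) := by
  have := UniformSpace.secondCountable_of_separable F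
  obtain ⟨M, O⟩ := isNonexpansiveLoss_featureLoss hV hV₀ hΦ hB hS hη
  have hpos : ∀ k, 1 ≤ k → 0 < stepSize η₁ β k := fun k => stepSize_pos hη₁
  have hnonneg := stepSize_nonneg (β := β) hη₁
  have hle : ∀ k, 1 ≤ k → stepSize η₁ β k ≤ η₁ := fun k => stepSize_le hη₁ hβ₀
  have hsum : 0 < ∑ k ∈ Finset.Ico 1 (t + 1), stepSize η₁ β k :=
    Finset.sum_pos (fun k hk => hpos k (by simp at hk; omega)) ⟨1, by simp; omega⟩
  have hmain : ExpectedExcessRiskLE ρ V Φ m g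
      (approxError ρ V Φ (∑ k ∈ Finset.Ico 1 (t + 1), stepSize η₁ β k)⁻¹ +
        ((a₀ * κ) ^ 2 / 2 * (stepSize η₁ β t + ∑ k ∈ Finset.Ico 1 t, stepSize η₁ β k ^ 2 /
          ∑ i ∈ Finset.Ico (k + 1) (t + 1), stepSize η₁ β i) +
        (m : ℝ)⁻¹ * (2 * (a₀ * κ) ^ 2 * ∑ k ∈ Finset.Ico 1 t, stepSize η₁ β k))) := by
    refine expectedExcessRiskLE_of_forall_risk_le ρ fun w => ?_
    rcases hg with rfl | rfl
    · have h := expected_risk_average_le (m := m) O hnonneg hpos hle ρ ht w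
      simp only [averagedIterate_eq_sum]
      exact ⟨h.1, h.2.trans_eq (by simp only [risk, featureLoss]; ring)⟩
    · have h := expected_risk_last_le (m := m) O hnonneg hpos hle ρ ht w
      simp only [iterate_eq_descent]
      exact ⟨h.1, h.2.trans_eq (by simp only [risk, featureLoss]; ring)⟩
  refine hmain.mono ?_
  have h1 := (hA _ (inv_pos.2 hsum)).trans
    (mul_le_mul_of_nonneg_left (inv_sum_stepSize_rpow_le hη₁ hβ₀ ht) hcβ.le)
  have h2 := mul_le_mul_of_nonneg_left (add_le_add_right
    (sum_sq_stepSize_div_le hη₁ hβ₀ hβ₁ ht) (stepSize η₁ β t))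
    (by positivity : 0 ≤ (a₀ * κ) ^ 2 / 2)
  have h3 := mul_le_mul_of_nonneg_left (mul_le_mul_of_nonneg_left (sum_stepSize_le hη₁ hβ₀ ht)
    (by positivity : 0 ≤ 2 * (a₀ * κ) ^ 2)) (by positivity : 0 ≤ (m : ℝ)⁻¹)
  rw [stepSize] at h2
  refine (add_le_add h1 (add_le_add h2 h3)).trans ?_
  have hlog : 0 ≤ Real.log t := Real.log_natCast_nonneg t
  have hD : 0 ≤ (a₀ * κ) ^ 2 * η₁ := by positivity
  have hE : 0 ≤ cβ * η₁ ^ (-β) := by positivity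
  have hT : 0 ≤ (t : ℝ) ^ (-(β / (β + 1))) := by positivity
  have hU : 0 ≤ (m : ℝ)⁻¹ * ((t : ℝ) ^ (1 / (β + 1)) * Real.log t) := by positivity
  have hTl := mul_nonneg hT hlog
  -- The coefficients of `(a₀ κ)² η₁` are `1/2` and `2` from optimization and `4` from stability,
  -- all at most `4`.
  linarith [mul_nonneg hD hT, mul_nonneg hD hTl, mul_nonneg hE hTl, mul_nonneg hE hU]

end Excess

end SGM

theorem corollary4
    (β cβ κ a₀ η₁ : ℝ) (hβ₀ : 0 < β) (hβ₁ : β ≤ 1) (hcβ : 0 < cβ) (hη₁ : 0 < η₁) :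
    ∃ C : ℝ, 0 < C ∧
      ∀ (X F : Type*) [MeasurableSpace X]
        [NormedAddCommGroup F] [InnerProductSpace ℝ F] [CompleteSpace F]
        [TopologicalSpace.SeparableSpace F] [MeasurableSpace F] [BorelSpace F]
        (Y : Set ℝ) (ρ : Measure (X × Y)) [IsProbabilityMeasure ρ]
        (V : ℝ → ℝ → ℝ) (Φ : X → F) (L : ℝ),
        Measurable (Function.uncurry V) → (∀ y a, 0 ≤ V y a) → Measurable Φ →
        SGM.BoundednessAssumption Y V Φ κ a₀ →
        SGM.ApproximationAssumption ρ V Φ β cβ →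
        SGM.SmoothnessAssumption Y V L →
        -- the condition `η₁ ≤ 2 / (κ² L)`, void when `κ = 0`
        η₁ * (κ ^ 2 * L) ≤ 2 →
        ∀ (m : ℕ) [NeZero m],
          (∀ t : ℕ, 1 ≤ t → ∀ g : (Fin m → X × Y) → (ℕ → Fin m) → F,
            (g = (fun z j => SGM.averagedIterate V Φ (SGM.stepSize η₁ β) z j t) ∨
              g = (fun z j => SGM.iterate V Φ (SGM.stepSize η₁ β) z j t)) →
            SGM.ExpectedExcessRiskLE ρ V Φ m g
              (C * ((m : ℝ)⁻¹ * ((t : ℝ) ^ (1 / (β + 1)) * Real.log t)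
                + (t : ℝ) ^ (-(β / (β + 1))) * Real.log t
                + (t : ℝ) ^ (-(β / (β + 1)))))) ∧
          (2 ≤ m → ∀ g : (Fin m → X × Y) → (ℕ → Fin m) → F,
            (g = (fun z j => SGM.averagedIterate V Φ (SGM.stepSize η₁ β) z j m) ∨
              g = (fun z j => SGM.iterate V Φ (SGM.stepSize η₁ β) z j m)) →
            SGM.ExpectedExcessRiskLE ρ V Φ m g
              (C * ((m : ℝ) ^ (-(β / (β + 1))) * Real.log m))) := by
  have hC₀ : 0 < cβ * η₁ ^ (-β) + 4 * (a₀ * κ) ^ 2 * η₁ :=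
    add_pos_of_pos_of_nonneg (by positivity) (by positivity)
  -- The factor 4 serves one pass: at `t = m` the first two terms coincide, and the third is at most
  -- twice either since `1 ≤ 2 log m` for `m ≥ 2`.
  refine ⟨4 * (cβ * η₁ ^ (-β) + 4 * (a₀ * κ) ^ 2 * η₁), by positivity, ?_⟩
  intro X F _ _ _ _ _ _ _ Y ρ _ V Φ L hV hV₀ hΦ hB hA hS hη m _
  have hmain := fun {t : ℕ} (ht : 1 ≤ t) {g : (Fin m → X × Y) → (ℕ → Fin m) → F} hg =>
    SGM.expectedExcessRiskLE_stochasticGradient (m := m) (t := t) (g := g) hβ₀ hβ₁ hcβ hη₁ hV hV₀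
      hΦ hB hA hS hη ht hg
  set C₀ := cβ * η₁ ^ (-β) + 4 * (a₀ * κ) ^ 2 * η₁
  refine ⟨fun t ht g hg => (hmain ht hg).mono ?_, fun hm g hg =>
    (hmain (one_le_two.trans hm) hg).mono ?_⟩
  · have hlog : 0 ≤ Real.log t := Real.log_natCast_nonneg t
    exact mul_le_mul_of_nonneg_right (by linarith) (by positivity)
  · have hm0 : (0 : ℝ) < m := by exact_mod_cast two_pos.trans_le hm
    have hpow : (m : ℝ)⁻¹ * ((m : ℝ) ^ (1 / (β + 1)) * Real.log m) =
        (m : ℝ) ^ (-(β / (β + 1))) * Real.log m := by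
      rw [← mul_assoc, ← Real.rpow_neg_one, ← Real.rpow_add hm0, ← SGM.one_sub_div_add_one hβ₀]
      congr 2
      ring
    have hlog : 1 ≤ 2 * Real.log m := by
      have := Real.log_le_log two_pos (by exact_mod_cast hm : (2 : ℝ) ≤ m)
      linarith [Real.log_two_gt_d9]
    have hT : 0 ≤ (m : ℝ) ^ (-(β / (β + 1))) := by positivity
    rw [hpow, mul_comm 4, mul_assoc]
    refine mul_le_mul_of_nonneg_left ?_ hC₀.le
    linarith [mul_le_mul_of_nonneg_left hlog hT]
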